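/- Let $(R,\mu)$ be a $\sigma$-finite nonatomic measure space and let $1<p<s\le\infty$. For a measurable scalar function $f$ on $R$ let $f^*(t)=\inf\{y\ge 0:\mu\{|f|>y\}\le t\}$, $t>0$, be its non-increasing rearrangement, and put $$\|f\|_{p,s}=\Big(\int_0^\infty \big(t^{1/p}f^*(t)\big)^s\,\frac{dt}{t}\Big)^{1/s}\quad (s<\infty),\qquad \|f\|_{p,\infty}=\sup_{t>0}t^{1/p}f^*(t).$$ Let $L^{p,s}(R,\mu)$ be the space of all $f$ with $\|f\|_{p,s}<\infty$, and for $f\in L^{p,s}(R,\mu)$ let $$\|f\|_{(p,s)}=\inf\Big\{\sum_k\|f_k\|_{p,s}\Big\},$$ where the infimum is taken over all finite representations $f=\sum_k f_k$ ($\mu$-a.e.) with $f_k\in L^{p,s}(R,\mu)$. Let $$c_{p,s}=\Big(\frac ps\Big)^{1/s}\Big(\frac{p'}{s'}\Big)^{1/s'},$$ where $p',s'$ are the conjugate exponents of $p,s$ (so that $c_{p,\infty}=p'$). Then: 1. For every $N$ and all $f_1,\dots,f_N\in L^{p,s}(R,\mu)$, $$\Big\|\sum_{k=1}^N f_k\Big\|_{p,s}\le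 c_{p,s}\sum_{k=1}^N\|f_k\|_{p,s}.$$ 2. The constant is optimal: if $\mu\neq 0$ and the inequality in 1 holds with a constant $C$ in place of $c_{p,s}$, for all $N$ and all $f_1,\dots,f_N\in L^{p,s}(R,\mu)$, then $C\ge c_{p,s}$. 3. For every constant $C\in[0,\infty]$, the inequality in 1 holds with $C$ in place of $c_{p,s}$ (for all $N$ and all $f_1,\dots,f_N$) if and only if $\|f\|_{p,s}\le C\|f\|_{(p,s)}$ for all $f\in L^{p,s}(R,\mu)$. In particular $\|f\|_{p,s}\le c_{p,s}\|f\|_{(p,s)}$ for all $f\in L^{p,s}(R,\mu)$. 4. On $\mathbb R_+=(0,\infty)$ with Lebesgue measure, the function $\chi_{[0,1]}$ belongs to $L^{p,s}$ and $\|\chi_{[0,1]}\|_{p,s}=c_{p,s}\|\chi_{[0,1]}\|_{(p,s)}$. -/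

import Mathlib

open MeasureTheory Set
open scoped ENNReal

noncomputable section

namespace LorentzSpace

variable {R : Type*} [MeasurableSpace R] {𝕜 : Type*} [RCLike 𝕜]

/-- A measure is nonatomic if every measurable set of positive measure has a measurable subset of
strictly smaller positive measure. -/
def IsNonatomic (μ : Measure R) : Prop :=
  ∀ A : Set R, MeasurableSet A → 0 < μ A →
    ∃ B : Set R, B ⊆ A ∧ MeasurableSet B ∧ 0 < μ B ∧ μ B < μ A

/-- The distribution function `μ_f(y) = μ {x | |f x| > y}`. -/
def distribution (μ : Measure R) (f : R → 𝕜) (y : ℝ≥0∞) : ℝ≥0∞ :=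
  μ {x | y < ‖f x‖ₑ}

/-- The non-increasing rearrangement `f^*(t) = inf {y ≥ 0 | μ_f(y) ≤ t}`. It takes the value `∞` when
no finite `y` qualifies. -/
def rearrangement (μ : Measure R) (f : R → 𝕜) (t : ℝ) : ℝ≥0∞ :=
  sInf {y : ℝ≥0∞ | distribution μ f y ≤ ENNReal.ofReal t}

/-- The Lorentz functional `‖f‖_{p,s} = (∫_0^∞ (t^{1/p} f^*(t))^s dt/t)^{1/s}` for finite `s`, and
`‖f‖_{p,∞} = sup_{t > 0} t^{1/p} f^*(t)`, with values in `[0,∞]`. -/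
def lorentzNorm (p s : ℝ≥0∞) (μ : Measure R) (f : R → 𝕜) : ℝ≥0∞ :=
  if s = ∞ then
    ⨆ (t : ℝ) (_ : 0 < t), ENNReal.ofReal t ^ (1 / p.toReal) * rearrangement μ f t
  else
    (∫⁻ t in Ioi (0 : ℝ),
      (ENNReal.ofReal t ^ (1 / p.toReal) * rearrangement μ f t) ^ s.toReal / ENNReal.ofReal t) ^
        (1 / s.toReal)

/-- Membership in the Lorentz space `L^{p,s}(R,μ)`. -/
def MemLorentz (p s : ℝ≥0∞) (μ : Measure R) (f : R → 𝕜) : Prop :=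
  AEStronglyMeasurable f μ ∧ lorentzNorm p s μ f < ∞

/-- The decomposition norm `‖f‖_{(p,s)} = inf ∑ ‖g_k‖_{p,s}`, the infimum being over all finite
representations `f = ∑ g_k` (almost everywhere) with `g_k ∈ L^{p,s}(R,μ)`. -/
def decompositionNorm (p s : ℝ≥0∞) (μ : Measure R) (f : R → 𝕜) : ℝ≥0∞ :=
  ⨅ (N : ℕ) (g : Fin N → R → 𝕜) (_ : ∀ k, MemLorentz p s μ (g k))
    (_ : f =ᵐ[μ] fun x => ∑ k, g k x), ∑ k, lorentzNorm p s μ (g k)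

/-- The triangle inequality in `L^{p,s}(R,μ)`, uniform in the number of terms, holds with the
constant `C`. -/
def TriangleInequality (𝕜 : Type*) [RCLike 𝕜] (p s : ℝ≥0∞) (μ : Measure R) (C : ℝ≥0∞) : Prop :=
  ∀ (N : ℕ) (f : Fin N → R → 𝕜), (∀ k, MemLorentz p s μ (f k)) →
    lorentzNorm p s μ (fun x => ∑ k, f k x) ≤ C * ∑ k, lorentzNorm p s μ (f k)

/-- `‖f‖_{p,s} ≤ C ‖f‖_{(p,s)}` for all `f ∈ L^{p,s}(R,μ)`. -/
def DecompositionInequality (𝕜 : Type*) [RCLike 𝕜] (p s : ℝ≥0∞) (μ : Measure R) (C : ℝ≥0∞) :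
    Prop :=
  ∀ f : R → 𝕜, MemLorentz p s μ f →
    lorentzNorm p s μ f ≤ C * decompositionNorm p s μ f

/-- The constant `c_{p,s} = (p/s)^{1/s} (p'/s')^{1/s'}`. For `s = ∞` one has `s' = 1` and the first
factor is `0 ^ 0 = 1`, so that `c_{p,∞} = p'`. -/
def sharpConstant (p s : ℝ≥0∞) : ℝ≥0∞ :=
  (p / s) ^ (1 / s.toReal) *
    (p.conjExponent / s.conjExponent) ^ (1 / s.conjExponent.toReal)

end LorentzSpace

end

/-!
The proof passes from functions on `R` to decreasing functions on the half-line and back.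

*Upper bound.* The functional `f ↦ ∫_0^t f^*` is subadditive (`lintegral_rearrangement_sum_le`),
because `∫_0^t f^*` is the minimum over `y` of `∫ (|f| - y)_+ + t y`, attained at `y = f^*(t)`.
Hence the rearrangement of `∑ f_k` has a primitive that is at most the primitive of
`φ = ∑ f_k^*`. For `s = ∞` the claim follows from `t F^*(t) ≤ ∫_0^t F^*`, where `F = ∑ f_k`. For
`s < ∞` Minkowski's inequality bounds the norm of `φ` in `L^s(t^{s/p-1} dt)` by `∑ ‖f_k‖_{p,s}`, so
that it suffices to show that passing from `φ` to a decreasing function with smaller primitive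
increases this norm at most by the factor `c_{p,s}` (`lintegral_rpow_le_of_primitive_le`). For step
functions this is a statement about the maximum of a convex function under the constraints of
monotonicity and of the primitives. Moving mass between two neighbouring steps one reaches a point
where the number of steps can be reduced (`stepSum_le`). What is left is the case of one step
on `(a,b)`, which is Hölder's inequality together with the fact that the resulting constant is
largest for `a = 0` (`rpow_mul_sub_le`, `rpow_sub_mul_rpow_sub_le`).

*Sharpness.* Equality in Hölder's inequality for `a = 0` singles out `χ_E` and the function
`t^{-γ}`, where `1 - γ = s'/p'`. Split `E` into `n` parts of equal measure, which Sierpiński's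
theorem allows, and distribute `n` values of `t^{-γ}` over the parts. The `n` cyclic permutations
of this function have the same rearrangement, and their sum is a multiple of `χ_E`. As `n → ∞`
this gives `c_{p,s} ‖χ_E‖_{(p,s)} ≤ ‖χ_E‖_{p,s}` (`lorentzNorm_indicator`), from which both the
optimality of the constant and the equality for `χ_{[0,1]}` follow.
-/

namespace LorentzSpace

open Filter Topology

variable {R : Type*} [MeasurableSpace R] {𝕜 : Type*} [RCLike 𝕜]

/-! ### Rearrangements and the layer cake formula -/

lemma volume_setOf_ofReal_lt (D : ℝ≥0∞) :
    volume.restrict (Ioi (0 : ℝ)) {t : ℝ | ENNReal.ofReal t < D} = D := by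
  rcases eq_or_ne D ∞ with rfl | hD
  · simp
  · have : {t : ℝ | ENNReal.ofReal t < D} ∩ Ioi 0 = Ioo 0 D.toReal := by
      ext t
      simp only [mem_inter_iff, mem_ofPred_eq, mem_Ioi, mem_Ioo]
      rw [and_comm]
      exact and_congr_right fun ht => ENNReal.ofReal_lt_iff_lt_toReal ht.le hD
    rw [Measure.restrict_apply (measurableSet_lt (by fun_prop) measurable_const), this]
    simp [hD]

/-- The layer cake formula for functions with values in `[0,∞]`. -/
lemma lintegral_eq_lintegral_measure_lt {α : Type*} [MeasurableSpace α] (μ : Measure α) [SFinite μ]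
    {g : α → ℝ≥0∞} (hg : AEMeasurable g μ) :
    ∫⁻ x, g x ∂μ = ∫⁻ u in Ioi (0 : ℝ), μ {x | ENNReal.ofReal u < g x} := by
  wlog hm : Measurable g generalizing g
  · rw [lintegral_congr_ae hg.ae_eq_mk, this hg.measurable_mk.aemeasurable hg.measurable_mk]
    refine lintegral_congr fun u => measure_congr ?_
    filter_upwards [hg.ae_eq_mk] with x hx
    exact congrArg (fun y => ENNReal.ofReal u < y) hx.symm
  have hS : MeasurableSet {q : α × ℝ | ENNReal.ofReal q.2 < g q.1} :=
    measurableSet_lt (by fun_prop) (by fun_prop)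
  have h1 : ∀ x, g x = ∫⁻ u in Ioi (0 : ℝ),
      {q : α × ℝ | ENNReal.ofReal q.2 < g q.1}.indicator 1 (x, u) := by
    intro x
    conv_lhs => rw [← volume_setOf_ofReal_lt (g x)]
    exact (lintegral_indicator_one
      (measurableSet_lt (by fun_prop) measurable_const)).symm
  rw [lintegral_congr h1, lintegral_lintegral_swap]
  · refine lintegral_congr fun u => ?_
    exact lintegral_indicator_one
      (measurableSet_lt (f := fun _ => ENNReal.ofReal u) measurable_const hm)
  · exact (measurable_one.indicator hS).aemeasurable

/-- The distribution function and the rearrangement are generalized inverses of each other; this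
rests on the right continuity of the distribution function. -/
lemma lt_rearrangement_iff {μ : Measure R} {f : R → 𝕜} {t : ℝ} {u : ℝ≥0∞} :
    u < rearrangement μ f t ↔ ENNReal.ofReal t < distribution μ f u := by
  constructor
  · intro h
    by_contra! hc
    exact (show rearrangement μ f t ≤ u from sInf_le hc).not_gt h
  · intro h
    have hu : u < ∞ := by
      by_contra! hc
      simp [top_le_iff.1 hc, distribution] at h
    obtain ⟨v, hv, hvu, hlim⟩ := exists_seq_strictAnti_tendsto' hu
    have hU : {x | u < ‖f x‖ₑ} = ⋃ n, {x | v n < ‖f x‖ₑ} := by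
      ext x
      simp only [mem_ofPred_eq, mem_iUnion]
      exact ⟨fun hx => (hlim.eventually_lt_const hx).exists,
        fun ⟨n, hn⟩ => (hvu n).1.trans hn⟩
    have hmono : Monotone fun n => {x | v n < ‖f x‖ₑ} :=
      fun m n hmn x hx => (hv.antitone hmn).trans_lt hx
    rw [distribution, hU, hmono.measure_iUnion, lt_iSup_iff] at h
    obtain ⟨n, hn⟩ := h
    refine (hvu n).1.trans_le (le_sInf fun y hy => ?_)
    by_contra! hc
    exact (hn.trans_le (measure_mono fun x hx => hc.trans hx)).not_ge hy

lemma rearrangement_antitone (μ : Measure R) (f : R → 𝕜) : Antitone (rearrangement μ f) :=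
  fun _ _ h => sInf_le_sInf fun _ hy => le_trans hy (ENNReal.ofReal_le_ofReal h)

lemma measurable_rearrangement (μ : Measure R) (f : R → 𝕜) : Measurable (rearrangement μ f) :=
  (rearrangement_antitone μ f).measurable

lemma rearrangement_congr_ae {μ : Measure R} {f g : R → 𝕜} (h : f =ᵐ[μ] g) :
    rearrangement μ f = rearrangement μ g := by
  have : distribution μ f = distribution μ g := by
    ext y
    refine measure_congr ?_
    filter_upwards [h] with x hx
    exact congrArg (fun z : 𝕜 => y < ‖z‖ₑ) hx
  ext t
  simp [rearrangement, this]

lemma lorentzNorm_congr_ae {p s : ℝ≥0∞} {μ : Measure R} {f g : R → 𝕜} (h : f =ᵐ[μ] g) :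
    lorentzNorm p s μ f = lorentzNorm p s μ g := by
  simp [lorentzNorm, rearrangement_congr_ae h]

/-- A function and its rearrangement are equimeasurable, hence so are their truncations. -/
lemma lintegral_rearrangement_tsub {μ : Measure R} [SFinite μ] {f : R → 𝕜}
    (hf : AEStronglyMeasurable f μ) (y : ℝ≥0∞) :
    ∫⁻ t in Ioi (0 : ℝ), (rearrangement μ f t - y) = ∫⁻ x, (‖f x‖ₑ - y) ∂μ := by
  rw [lintegral_eq_lintegral_measure_lt _ (g := fun x => ‖f x‖ₑ - y) (hf.enorm.sub aemeasurable_const),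
    lintegral_eq_lintegral_measure_lt _ (g := fun t => rearrangement μ f t - y)
      ((measurable_rearrangement μ f).sub measurable_const).aemeasurable]
  refine lintegral_congr fun u => ?_
  simp_rw [lt_tsub_iff_left, lt_rearrangement_iff]
  exact volume_setOf_ofReal_lt _

/-- `∫_0^t f^* ≤ ∫ (|f| - y)_+ + t y` for every level `y`. -/
lemma lintegral_rearrangement_le {μ : Measure R} [SFinite μ] {f : R → 𝕜}
    (hf : AEStronglyMeasurable f μ) (y : ℝ≥0∞) (t : ℝ) :
    ∫⁻ u in Ioc 0 t, rearrangement μ f u ≤ ∫⁻ x, (‖f x‖ₑ - y) ∂μ + ENNReal.ofReal t * y := by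
  calc ∫⁻ u in Ioc 0 t, rearrangement μ f u
      ≤ ∫⁻ u in Ioc 0 t, ((rearrangement μ f u - y) + y) :=
        lintegral_mono fun u => le_tsub_add
    _ = (∫⁻ u in Ioc 0 t, (rearrangement μ f u - y)) + ENNReal.ofReal t * y := by
        rw [lintegral_add_right _ measurable_const]
        simp [mul_comm]
    _ ≤ (∫⁻ u in Ioi 0, (rearrangement μ f u - y)) + ENNReal.ofReal t * y := by
        gcongr
        exact Ioc_subset_Ioi_self
    _ = _ := by rw [lintegral_rearrangement_tsub hf]

/-- The level `y = f^*(t)` is optimal in `lintegral_rearrangement_le`. -/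
lemma lintegral_tsub_rearrangement {μ : Measure R} [SFinite μ] {f : R → 𝕜}
    (hf : AEStronglyMeasurable f μ) {t : ℝ} (ht : 0 ≤ t) :
    ∫⁻ x, (‖f x‖ₑ - rearrangement μ f t) ∂μ + ENNReal.ofReal t * rearrangement μ f t =
      ∫⁻ u in Ioc 0 t, rearrangement μ f u := by
  rw [← lintegral_rearrangement_tsub hf, ← Ioc_union_Ioi_eq_Ioi ht,
    lintegral_union measurableSet_Ioi (Set.Ioc_disjoint_Ioi le_rfl)]
  have h0 : ∫⁻ u in Ioi t, (rearrangement μ f u - rearrangement μ f t) = 0 := by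
    rw [setLIntegral_congr_fun (g := fun _ => 0) measurableSet_Ioi]
    · simp
    · exact fun u hu => tsub_eq_zero_of_le (rearrangement_antitone μ f (le_of_lt hu))
  have h1 : ENNReal.ofReal t * rearrangement μ f t =
      ∫⁻ _ in Ioc 0 t, rearrangement μ f t := by simp [mul_comm]
  rw [h0, add_zero, h1, ← lintegral_add_right _ measurable_const]
  exact setLIntegral_congr_fun measurableSet_Ioc fun u hu =>
    tsub_add_cancel_of_le (rearrangement_antitone μ f hu.2)

lemma tsub_sum_le {ι : Type*} (A : Finset ι) (a b : ι → ℝ≥0∞) :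
    ∑ i ∈ A, a i - ∑ i ∈ A, b i ≤ ∑ i ∈ A, (a i - b i) := by
  rw [tsub_le_iff_right, ← Finset.sum_add_distrib]
  exact Finset.sum_le_sum fun i _ => le_tsub_add

/-- The subadditivity of `f ↦ ∫_0^t f^*`. Truncating each `f_k` at its own level `f_k^*(t)` and
the sum at the sum of these levels reduces it to the pointwise triangle inequality. -/
lemma lintegral_rearrangement_sum_le {μ : Measure R} [SFinite μ] {N : ℕ} {f : Fin N → R → 𝕜}
    (hf : ∀ k, AEStronglyMeasurable (f k) μ) {t : ℝ} (ht : 0 ≤ t) :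
    ∫⁻ u in Ioc 0 t, rearrangement μ (fun x => ∑ k, f k x) u ≤
      ∫⁻ u in Ioc 0 t, ∑ k, rearrangement μ (f k) u := by
  calc ∫⁻ u in Ioc 0 t, rearrangement μ (fun x => ∑ k, f k x) u
      ≤ ∫⁻ x, (‖∑ k, f k x‖ₑ - ∑ k, rearrangement μ (f k) t) ∂μ +
          ENNReal.ofReal t * ∑ k, rearrangement μ (f k) t :=
        lintegral_rearrangement_le (Finset.aestronglyMeasurable_fun_sum _ fun k _ => hf k) _ t
    _ ≤ ∫⁻ x, ∑ k, (‖f k x‖ₑ - rearrangement μ (f k) t) ∂μ +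
          ENNReal.ofReal t * ∑ k, rearrangement μ (f k) t := by
        gcongr with x
        exact (tsub_le_tsub_right (enorm_sum_le _ _) _).trans (tsub_sum_le _ _ _)
    _ = ∑ k, (∫⁻ x, (‖f k x‖ₑ - rearrangement μ (f k) t) ∂μ +
          ENNReal.ofReal t * rearrangement μ (f k) t) := by
        rw [lintegral_finsetSum' (f := fun k x => ‖f k x‖ₑ - rearrangement μ (f k) t) _
            fun k _ => (hf k).enorm.sub aemeasurable_const,
          Finset.sum_add_distrib, Finset.mul_sum]
    _ = _ := by
        rw [lintegral_finsetSum _ fun k _ => measurable_rearrangement μ (f k)]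
        exact Finset.sum_congr rfl fun k _ => lintegral_tsub_rearrangement (hf k) ht

/-! ### An inequality for decreasing step functions -/

/-- The sum `∑ v_i ^ s (W(b_i) - W(b_{i-1}))` for the step function that takes the value `v_i` on
the interval `(b_{i-1}, b_i]`, where `b_0 = a` and the `(b_i, v_i)` are the entries of the list. -/
noncomputable def stepSum (s : ℝ) (W : ℝ → ℝ) : ℝ → List (ℝ × ℝ) → ℝ
  | _, [] => 0
  | a, (b, v) :: l => v ^ s * (W b - W a) + stepSum s W b l

/-- The step function encoded by a list is nonnegative, decreasing and bounded by `u`, and its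
primitive with value `M` at `a` is at most `Φ` at every breakpoint. -/
def StepAdmissible (Φ : ℝ → ℝ) : ℝ → ℝ → ℝ → List (ℝ × ℝ) → Prop
  | _, _, _, [] => True
  | a, M, u, (b, v) :: l => a < b ∧ 0 ≤ v ∧ v ≤ u ∧ M + v * (b - a) ≤ Φ b ∧
      StepAdmissible Φ b (M + v * (b - a)) v l

/-- The right endpoint of the domain of the step function encoded by a list. -/
def stepEnd : ℝ → List (ℝ × ℝ) → ℝ
  | a, [] => a
  | _, (b, _) :: l => stepEnd b l

lemma StepAdmissible.mono {Φ : ℝ → ℝ} {a M u u' : ℝ} {l : List (ℝ × ℝ)}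
    (h : StepAdmissible Φ a M u l) (hu : u ≤ u') : StepAdmissible Φ a M u' l := by
  cases l with
  | nil => trivial
  | cons x l => exact ⟨h.1, h.2.1, h.2.2.1.trans hu, h.2.2.2⟩

/-- Two consecutive steps of the same height form one step. -/
lemma StepAdmissible.merge {Φ : ℝ → ℝ} {a M u b c v : ℝ} {l : List (ℝ × ℝ)}
    (h : StepAdmissible Φ a M u ((b, v) :: (c, v) :: l)) :
    StepAdmissible Φ a M u ((c, v) :: l) := by
  obtain ⟨h1, h2, h3, -, h5, -, -, h8, h9⟩ := h
  have e : M + v * (b - a) + v * (c - b) = M + v * (c - a) := by ring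
  rw [e] at h8 h9
  exact ⟨h1.trans h5, h2, h3, h8, h9⟩

/-- Along a line, a sum of `s`-th powers is at most its value at one of the two endpoints. -/
lemma rpow_add_rpow_le_max {s : ℝ} (hs : 1 ≤ s) {A B p q p' q' x y : ℝ} (hA : 0 ≤ A) (hB : 0 ≤ B)
    (hp : 0 ≤ p) (hq : 0 ≤ q) (hp' : 0 ≤ p') (hq' : 0 ≤ q') (hx : 0 ≤ x) (hy : 0 ≤ y)
    (hxy : x + y = 1) :
    (x * p + y * p') ^ s * A + (x * q + y * q') ^ s * B ≤
      max (p ^ s * A + q ^ s * B) (p' ^ s * A + q' ^ s * B) := by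
  have h1 := (convexOn_rpow hs).2 (mem_Ici.2 hp) (mem_Ici.2 hp') hx hy hxy
  have h2 := (convexOn_rpow hs).2 (mem_Ici.2 hq) (mem_Ici.2 hq') hx hy hxy
  simp only [smul_eq_mul] at h1 h2
  have h3 := mul_le_mul_of_nonneg_right h1 hA
  have h4 := mul_le_mul_of_nonneg_right h2 hB
  have h5 := mul_le_mul_of_nonneg_left (le_max_left (p ^ s * A + q ^ s * B)
    (p' ^ s * A + q' ^ s * B)) hx
  have h6 := mul_le_mul_of_nonneg_left (le_max_right (p ^ s * A + q ^ s * B)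
    (p' ^ s * A + q' ^ s * B)) hy
  have h7 : max (p ^ s * A + q ^ s * B) (p' ^ s * A + q' ^ s * B) =
    x * max (p ^ s * A + q ^ s * B) (p' ^ s * A + q' ^ s * B) +
    y * max (p ^ s * A + q ^ s * B) (p' ^ s * A + q' ^ s * B) := by rw [← add_mul, hxy, one_mul]
  linarith

/-- The inequality for a single step implies the one for every decreasing step function. Moving
mass between the first two steps is a motion along a line, on which the convex function `stepSum`
is at most its value at an endpoint. At the endpoints either two steps merge, or the last step
vanishes, or the constraint at the first breakpoint becomes an equality and the interval splits
there; in each case the number of steps drops. -/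
lemma stepSum_le {s : ℝ} (hs : 1 ≤ s) {Φ W Ψ : ℝ → ℝ} (hW : MonotoneOn W (Ici 0))
    (hΨ : MonotoneOn Ψ (Ici 0))
    (hbase : ∀ a b v, 0 ≤ a → a < b → 0 ≤ v → v * (b - a) ≤ Φ b - Φ a →
      v ^ s * (W b - W a) ≤ Ψ b - Ψ a) (n : ℕ) :
    ∀ (l : List (ℝ × ℝ)), l.length ≤ n → ∀ a u, 0 ≤ a → StepAdmissible Φ a (Φ a) u l →
      stepSum s W a l ≤ Ψ (stepEnd a l) - Ψ a := by
  induction n with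
  | zero =>
    intro l hl a u _ _
    obtain rfl : l = [] := List.length_eq_zero_iff.1 (Nat.le_zero.1 hl)
    simp [stepSum, stepEnd]
  | succ n ih =>
    intro l hl a u ha hadm
    match l, hl, hadm with
    | [], _, _ => simp [stepSum, stepEnd]
    | [(b, v)], _, hadm =>
      obtain ⟨h1, h2, -, h4, -⟩ := hadm
      simpa [stepSum, stepEnd] using hbase a b v ha h1 h2 (by linarith)
    | (b, v) :: (c, w) :: l, hl, hadm =>
      have hb : a < b := hadm.1
      have hc : b < c := hadm.2.2.2.2.1
      have hw : 0 ≤ w := hadm.2.2.2.2.2.1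
      have hwv : w ≤ v := hadm.2.2.2.2.2.2.1
      have hM : Φ a + v * (b - a) ≤ Φ b := hadm.2.2.2.1
      have hM' : Φ a + v * (b - a) + w * (c - b) ≤ Φ c := hadm.2.2.2.2.2.2.2.1
      have hrest := hadm.2.2.2.2.2.2.2.2
      have hb0 : 0 < b - a := by linarith
      have hc0 : 0 < c - b := by linarith
      have hlen : l.length + 1 ≤ n := by simpa using hl
      -- the common height `m` after equalizing the first two steps
      set m := (v * (b - a) + w * (c - b)) / (c - a) with hm
      have hma : m * (c - a) = v * (b - a) + w * (c - b) := by
        rw [hm, div_mul_cancel₀]; linarith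
      have hwm : w ≤ m := by
        rw [hm, le_div_iff₀ (by linarith)]; nlinarith
      have hmv : m ≤ v := by
        rw [hm, div_le_iff₀ (by linarith)]; nlinarith
      have hW1 : 0 ≤ W b - W a := sub_nonneg.2 (hW ha (mem_Ici.2 (by linarith)) hb.le)
      have hW2 : 0 ≤ W c - W b :=
        sub_nonneg.2 (hW (mem_Ici.2 (by linarith)) (mem_Ici.2 (by linarith)) hc.le)
      have heq : m ^ s * (W b - W a) + m ^ s * (W c - W b) + stepSum s W c l ≤
          Ψ (stepEnd c l) - Ψ a := by
        have := ih ((c, m) :: l) hlen a m ha ⟨by linarith, by linarith, le_rfl, by linarith, by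
          rw [hma, ← add_assoc]; exact hrest.mono hwm⟩
        simp only [stepSum, stepEnd] at this
        linarith
      -- `r` is the height of the third step, or `0` if there is none
      obtain ⟨r, hr0, hrw, hradm, hrS⟩ : ∃ r, 0 ≤ r ∧ r ≤ w ∧
          StepAdmissible Φ c (Φ a + v * (b - a) + w * (c - b)) r l ∧
          ∀ v', 0 ≤ v' → Φ a + v' * (b - a) ≤ Φ b →
            v' * (b - a) + r * (c - b) = v * (b - a) + w * (c - b) → r ≤ v' →
            v' ^ s * (W b - W a) + r ^ s * (W c - W b) + stepSum s W c l ≤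
              Ψ (stepEnd c l) - Ψ a := by
        cases l with
        | nil =>
          refine ⟨0, le_rfl, hw, trivial, fun v' hv' h1 _ _ => ?_⟩
          have h3 := hbase a b v' ha hb hv' (by linarith)
          have h4 := hΨ (mem_Ici.2 (by linarith)) (mem_Ici.2 (by linarith)) hc.le
          simp only [stepSum, stepEnd, Real.zero_rpow (by linarith : s ≠ 0)]
          linarith
        | cons x l =>
          obtain ⟨d, r⟩ := x
          refine ⟨r, hrest.2.1, hrest.2.2.1, ⟨hrest.1, hrest.2.1, le_rfl, hrest.2.2.2⟩,
            fun v' hv' h1 h2 h3 => ?_⟩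
          have hd : c < d := hrest.1
          have e : Φ a + v' * (b - a) + r * (c - b) = Φ a + v * (b - a) + w * (c - b) := by
            linarith
          have key : StepAdmissible Φ a (Φ a) v' ((b, v') :: (c, r) :: (d, r) :: l) := by
            refine ⟨hb, hv', le_rfl, h1, hc, hrest.2.1, h3, ?_, ?_⟩
            · rw [e]; exact hM'
            · rw [e]; exact ⟨hrest.1, hrest.2.1, le_rfl, hrest.2.2.2⟩
          have key' : StepAdmissible Φ a (Φ a) v' ((b, v') :: (d, r) :: l) :=
            ⟨hb, hv', le_rfl, h1, key.2.2.2.2.merge⟩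
          have := ih _ (by simpa using hlen) a v' ha key'
          simp only [stepSum, stepEnd] at this ⊢
          linarith
      -- the heights `(v₁, w₁)` after moving as much mass to the left as possible
      obtain ⟨v₁, w₁, hv₁, hw₁, hmass, hS⟩ : ∃ v₁ w₁, v ≤ v₁ ∧ 0 ≤ w₁ ∧
          v₁ * (b - a) + w₁ * (c - b) = v * (b - a) + w * (c - b) ∧
          v₁ ^ s * (W b - W a) + w₁ ^ s * (W c - W b) + stepSum s W c l ≤
            Ψ (stepEnd c l) - Ψ a := by
        rcases le_total ((w - r) * (c - b)) (Φ b - Φ a - v * (b - a)) with hcase | hcase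
        · have hq : (w - r) * (c - b) / (b - a) * (b - a) = (w - r) * (c - b) :=
            div_mul_cancel₀ _ hb0.ne'
          have hq0 : 0 ≤ (w - r) * (c - b) / (b - a) :=
            div_nonneg (mul_nonneg (by linarith) hc0.le) hb0.le
          have e : (v + (w - r) * (c - b) / (b - a)) * (b - a) + r * (c - b) =
            v * (b - a) + w * (c - b) := by linear_combination hq
          exact ⟨v + (w - r) * (c - b) / (b - a), r, by linarith, hr0, e,
            hrS _ (by linarith) (by linarith) e (by linarith)⟩
        · set x := Φ b - Φ a - v * (b - a) with hx
          have hx0 : 0 ≤ x := by linarith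
          have hq : x / (b - a) * (b - a) = x := div_mul_cancel₀ _ hb0.ne'
          have hq' : x / (c - b) * (c - b) = x := div_mul_cancel₀ _ hc0.ne'
          have hq0 : 0 ≤ x / (b - a) := div_nonneg hx0 hb0.le
          have hq0' : 0 ≤ x / (c - b) := div_nonneg hx0 hc0.le
          have hwr : r ≤ w - x / (c - b) := by
            have : x / (c - b) ≤ w - r := by rwa [div_le_iff₀ hc0]
            linarith
          have e : (v + x / (b - a)) * (b - a) + (w - x / (c - b)) * (c - b) =
            v * (b - a) + w * (c - b) := by linear_combination hq - hq'
          have e1 : Φ b - Φ a = (v + x / (b - a)) * (b - a) := by linear_combination hx - hq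
          refine ⟨v + x / (b - a), w - x / (c - b), by linarith, by linarith, e, ?_⟩
          have h1 := hbase a b (v + x / (b - a)) ha hb (by linarith) (by linarith)
          have h2 := ih ((c, w - x / (c - b)) :: l) hlen b (w - x / (c - b)) (by linarith)
            ⟨hc, by linarith, le_rfl, by linarith, by
              have e2 : Φ b + (w - x / (c - b)) * (c - b) =
                Φ a + v * (b - a) + w * (c - b) := by linarith
              rw [e2]; exact hradm.mono hwr⟩
          simp only [stepSum, stepEnd] at h2
          linarith
      -- `(v, w)` lies on the segment between `(m, m)` and `(v₁, w₁)`
      obtain ⟨x, y, hx, hy, hxy, hvx⟩ : ∃ x y : ℝ, 0 ≤ x ∧ 0 ≤ y ∧ x + y = 1 ∧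
          x * m + y * v₁ = v := by
        have : v ∈ segment ℝ m v₁ := by
          rw [segment_eq_Icc (hmv.trans hv₁)]; exact ⟨hmv, hv₁⟩
        simpa [segment] using this
      have hwx : x * m + y * w₁ = w := by
        have : (x * m + y * w₁) * (c - b) = w * (c - b) := by
          obtain rfl : x = 1 - y := by linarith
          linear_combination (1 - y) * hma + y * hmass - (b - a) * hvx
        exact mul_right_cancel₀ hc0.ne' this
      have hmax := rpow_add_rpow_le_max hs hW1 hW2 (by linarith : 0 ≤ m) (by linarith : 0 ≤ m)
        (by linarith : 0 ≤ v₁) hw₁ hx hy hxy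
      rw [hvx, hwx] at hmax
      simp only [stepSum, stepEnd]
      rcases le_max_iff.1 hmax with h | h <;> linarith

/-! ### The inequality for decreasing functions -/

lemma lintegral_rpow_Ioc {r a b : ℝ} (hr : -1 < r) (ha : 0 ≤ a) (hab : a ≤ b) :
    ∫⁻ t in Ioc a b, ENNReal.ofReal (t ^ r) =
      ENNReal.ofReal ((b ^ (r + 1) - a ^ (r + 1)) / (r + 1)) := by
  rw [← ofReal_integral_eq_lintegral_ofReal, ← intervalIntegral.integral_of_le hab,
    integral_rpow (Or.inl hr)]
  · exact (intervalIntegrable_iff_integrableOn_Ioc_of_le hab).1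
      (intervalIntegral.intervalIntegrable_rpow' hr)
  · filter_upwards [ae_restrict_mem measurableSet_Ioc] with t ht
    exact Real.rpow_nonneg (ha.trans ht.1.le) r

/-- Among the intervals `(a,b)`, the product of the averages of the two power weights that enters
Hölder's inequality is largest when `a = 0`. -/
lemma rpow_sub_mul_rpow_sub_le {s A B a b : ℝ} (hs : 1 < s) (hA : 0 ≤ A) (hB : 0 ≤ B)
    (hAB : A * (s - 1) + B = s) (ha : 0 ≤ a) (hab : a < b) :
    (b ^ A - a ^ A) ^ (s - 1) * (b ^ B - a ^ B) ≤ (b - a) ^ s := by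
  have hb : 0 < b := ha.trans_lt hab
  have hs0 : 0 < s := by linarith
  set x := a / b with hx
  have hx0 : 0 ≤ x := div_nonneg ha hb.le
  have hx1 : x ≤ 1 := (div_le_one hb).2 hab.le
  have hax : a = b * x := by rw [hx, mul_div_cancel₀ _ hb.ne']
  have h1 : 0 ≤ 1 - x ^ A := sub_nonneg.2 (Real.rpow_le_one hx0 hx1 hA)
  have h2 : 0 ≤ 1 - x ^ B := sub_nonneg.2 (Real.rpow_le_one hx0 hx1 hB)
  have hw : (s - 1) / s + 1 / s = 1 := by field_simp; ring
  have hw1 : 0 ≤ (s - 1) / s := div_nonneg (by linarith) hs0.le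
  have hw2 : 0 ≤ 1 / s := by positivity
  have e1 := Real.geom_mean_le_arith_mean2_weighted hw1 hw2 h1 h2 hw
  have e2 := Real.geom_mean_le_arith_mean2_weighted hw1 hw2 (Real.rpow_nonneg hx0 A)
    (Real.rpow_nonneg hx0 B) hw
  have e3 : (x ^ A) ^ ((s - 1) / s) * (x ^ B) ^ (1 / s) = x := by
    rw [← Real.rpow_mul hx0, ← Real.rpow_mul hx0, ← Real.rpow_add_of_nonneg hx0 (by positivity)
      (by positivity)]
    have : A * ((s - 1) / s) + B * (1 / s) = 1 := by field_simp; linarith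
    rw [this, Real.rpow_one]
  rw [e3] at e2
  have e4 : (1 - x ^ A) ^ ((s - 1) / s) * (1 - x ^ B) ^ (1 / s) ≤ 1 - x := by
    linear_combination e1 + e2 + hw
  have e5 := Real.rpow_le_rpow (by positivity) e4 hs0.le
  rw [Real.mul_rpow (by positivity) (by positivity), ← Real.rpow_mul h1, ← Real.rpow_mul h2,
    div_mul_cancel₀ _ hs0.ne', div_mul_cancel₀ _ hs0.ne', Real.rpow_one] at e5
  rw [hax, Real.mul_rpow hb.le hx0, Real.mul_rpow hb.le hx0]
  have g1 : b ^ A - b ^ A * x ^ A = b ^ A * (1 - x ^ A) := by ring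
  have g2 : b ^ B - b ^ B * x ^ B = b ^ B * (1 - x ^ B) := by ring
  have g3 : b - b * x = b * (1 - x) := by ring
  have g4 : b ^ s = (b ^ A) ^ (s - 1) * b ^ B := by
    rw [← Real.rpow_mul hb.le, ← Real.rpow_add hb, hAB]
  rw [g1, g2, g3, Real.mul_rpow (by positivity) h1, Real.mul_rpow hb.le (by linarith), g4]
  calc (b ^ A) ^ (s - 1) * (1 - x ^ A) ^ (s - 1) * (b ^ B * (1 - x ^ B))
      = (b ^ A) ^ (s - 1) * b ^ B * ((1 - x ^ A) ^ (s - 1) * (1 - x ^ B)) := by ring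
    _ ≤ _ := by gcongr

/-- Hölder's inequality with the weight `t ^ (B - 1)`. -/
lemma lintegral_Ioc_le_weighted {s A B a b : ℝ} (hs : 1 < s) (hA : 0 < A)
    (hAB : A * (s - 1) + B = s) (ha : 0 ≤ a) (hab : a ≤ b) {φ : ℝ → ℝ≥0∞} (hφ : Measurable φ) :
    ∫⁻ t in Ioc a b, φ t ≤
      (∫⁻ t in Ioc a b, φ t ^ s * ENNReal.ofReal (t ^ (B - 1))) ^ (1 / s) *
        ENNReal.ofReal ((b ^ A - a ^ A) / A) ^ ((s - 1) / s) := by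
  have hs0 : 0 < s := by linarith
  have hs1 : 0 < s - 1 := by linarith
  have hpq : s.HolderConjugate (s / (s - 1)) :=
    (Real.holderConjugate_iff_eq_conjExponent hs).2 rfl
  have := ENNReal.lintegral_mul_le_Lp_mul_Lq (volume.restrict (Ioc a b)) hpq
    (f := fun t => φ t * ENNReal.ofReal (t ^ ((B - 1) / s)))
    (g := fun t => ENNReal.ofReal (t ^ (-((B - 1) / s)))) (by fun_prop) (by fun_prop)
  calc ∫⁻ t in Ioc a b, φ t
      = ∫⁻ t in Ioc a b, ((fun t => φ t * ENNReal.ofReal (t ^ ((B - 1) / s))) *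
          fun t => ENNReal.ofReal (t ^ (-((B - 1) / s)))) t := by
        refine setLIntegral_congr_fun measurableSet_Ioc fun t ht => ?_
        have ht0 : 0 < t := ha.trans_lt ht.1
        simp only [Pi.mul_apply]
        rw [mul_assoc, ← ENNReal.ofReal_mul (by positivity), ← Real.rpow_add ht0]
        simp
    _ ≤ _ := this
    _ = _ := by
        congr 1
        · congr 1
          refine setLIntegral_congr_fun measurableSet_Ioc fun t ht => ?_
          have ht0 : 0 < t := ha.trans_lt ht.1
          rw [ENNReal.mul_rpow_of_nonneg _ _ hs0.le,
            ENNReal.ofReal_rpow_of_nonneg (by positivity) hs0.le, ← Real.rpow_mul ht0.le,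
            div_mul_cancel₀ _ hs0.ne']
        · rw [one_div_div]
          congr 1
          have hr : -((B - 1) / s) * (s / (s - 1)) = A - 1 := by
            field_simp
            linarith
          rw [setLIntegral_congr_fun (g := fun t => ENNReal.ofReal (t ^ (A - 1)))
            measurableSet_Ioc, lintegral_rpow_Ioc (by linarith) ha hab, sub_add_cancel]
          intro t ht
          have ht0 : 0 < t := ha.trans_lt ht.1
          simp only
          rw [ENNReal.ofReal_rpow_of_nonneg (by positivity) (by positivity),
            ← Real.rpow_mul ht0.le, hr]

lemma lintegral_Ioc_add {f : ℝ → ℝ≥0∞} {a b c : ℝ} (hab : a ≤ b) (hbc : b ≤ c) :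
    ∫⁻ t in Ioc a c, f t = (∫⁻ t in Ioc a b, f t) + ∫⁻ t in Ioc b c, f t := by
  rw [← Ioc_union_Ioc_eq_Ioc hab hbc, lintegral_union measurableSet_Ioc]
  exact Set.Ioc_disjoint_Ioc_of_le le_rfl

/-- The inequality for one step: a function of constant height `v` on `(a,b]`, whose integral is at
most that of `φ`. -/
lemma rpow_mul_sub_le {s A B a b v : ℝ} (hs : 1 < s) (hA : 0 < A) (hB : 0 < B)
    (hAB : A * (s - 1) + B = s) (ha : 0 ≤ a) (hab : a < b) (hv : 0 ≤ v) {φ : ℝ → ℝ≥0∞}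
    (hφ : Measurable φ)
    (hfin : ∫⁻ t in Ioc a b, φ t ^ s * ENNReal.ofReal (t ^ (B - 1)) ≠ ∞)
    (h : v * (b - a) ≤ (∫⁻ t in Ioc a b, φ t).toReal) :
    v ^ s * ((b ^ B - a ^ B) / B) ≤ A ^ (1 - s) / B *
      (∫⁻ t in Ioc a b, φ t ^ s * ENNReal.ofReal (t ^ (B - 1))).toReal := by
  have hs0 : 0 < s := by linarith
  have hs1 : 0 < s - 1 := by linarith
  have hb0 : 0 < b - a := by linarith
  set I := ∫⁻ t in Ioc a b, φ t ^ s * ENNReal.ofReal (t ^ (B - 1)) with hI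
  have hAa : 0 ≤ b ^ A - a ^ A := sub_nonneg.2 (Real.rpow_le_rpow ha hab.le hA.le)
  have hBa : 0 ≤ b ^ B - a ^ B := sub_nonneg.2 (Real.rpow_le_rpow ha hab.le hB.le)
  have h1 : v * (b - a) ≤ I.toReal ^ (1 / s) * ((b ^ A - a ^ A) / A) ^ ((s - 1) / s) := by
    refine h.trans ?_
    have := ENNReal.toReal_mono (by finiteness) (lintegral_Ioc_le_weighted hs hA hAB ha hab.le hφ)
    rwa [ENNReal.toReal_mul, ← ENNReal.toReal_rpow, ← ENNReal.toReal_rpow,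
      ENNReal.toReal_ofReal (by positivity)] at this
  have h2 := Real.rpow_le_rpow (by positivity) h1 hs0.le
  rw [Real.mul_rpow hv hb0.le, Real.mul_rpow (by positivity) (by positivity), ← Real.rpow_mul
    (by positivity), ← Real.rpow_mul (by positivity), div_mul_cancel₀ _ hs0.ne',
    div_mul_cancel₀ _ hs0.ne', Real.rpow_one, Real.div_rpow hAa hA.le] at h2
  have h3 := rpow_sub_mul_rpow_sub_le hs hA.le hB.le hAB ha hab
  have hK : A ^ (1 - s) = (A ^ (s - 1))⁻¹ := by rw [← Real.rpow_neg hA.le, neg_sub]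
  refine le_of_mul_le_mul_right ?_ (Real.rpow_pos_of_pos hb0 s)
  calc v ^ s * ((b ^ B - a ^ B) / B) * (b - a) ^ s
      = (v ^ s * (b - a) ^ s) * ((b ^ B - a ^ B) / B) := by ring
    _ ≤ (I.toReal * ((b ^ A - a ^ A) ^ (s - 1) / A ^ (s - 1))) * ((b ^ B - a ^ B) / B) := by
        gcongr
    _ = A ^ (1 - s) / B * I.toReal * ((b ^ A - a ^ A) ^ (s - 1) * (b ^ B - a ^ B)) := by
        rw [hK]; ring
    _ ≤ _ := by gcongr

/-- The step function below the decreasing function `g` with `m` steps of width `h` to the right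
of `a`, each step taking the value of `g` at its right endpoint. -/
def stepList (g : ℝ → ℝ) (h : ℝ) : ℝ → ℕ → List (ℝ × ℝ)
  | _, 0 => []
  | a, m + 1 => (a + h, g (a + h)) :: stepList g h (a + h) m

lemma stepEnd_stepList (g : ℝ → ℝ) (h a : ℝ) (m : ℕ) :
    stepEnd a (stepList g h a m) = a + m * h := by
  induction m generalizing a with
  | zero => simp [stepList, stepEnd]
  | succ m ih =>
    simp only [stepList, stepEnd, ih]
    push_cast
    ring

lemma length_stepList (g : ℝ → ℝ) (h a : ℝ) (m : ℕ) : (stepList g h a m).length = m := by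
  induction m generalizing a with
  | zero => rfl
  | succ m ih => simp [stepList, ih]

lemma stepAdmissible_stepList {f φ : ℝ → ℝ≥0∞} (hf : AntitoneOn f (Ioi 0))
    (hφ : ∀ t, 0 < t → ∫⁻ u in Ioc 0 t, φ u ≠ ∞)
    (hle : ∀ t, 0 < t → ∫⁻ u in Ioc 0 t, f u ≤ ∫⁻ u in Ioc 0 t, φ u)
    (hfin : ∀ t, 0 < t → f t ≠ ∞) {h : ℝ} (hh : 0 < h) (m : ℕ) :
    ∀ a M u, 0 ≤ a → M ≤ (∫⁻ u in Ioc 0 a, f u).toReal → (f (a + h)).toReal ≤ u →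
      StepAdmissible (fun t => (∫⁻ u in Ioc 0 t, φ u).toReal) a M u
        (stepList (fun t => (f t).toReal) h a m) := by
  induction m with
  | zero => intros; trivial
  | succ m ih =>
    intro a M u ha hM hu
    have hah : 0 < a + h := by linarith
    have hF : ∫⁻ u in Ioc 0 (a + h), f u ≠ ∞ := ne_top_of_le_ne_top (hφ _ hah) (hle _ hah)
    have hsplit := lintegral_Ioc_add (f := f) ha (by linarith : a ≤ a + h)
    have h1 : f (a + h) * ENNReal.ofReal h ≤ ∫⁻ u in Ioc a (a + h), f u := by
      calc f (a + h) * ENNReal.ofReal h = ∫⁻ _ in Ioc a (a + h), f (a + h) := by simp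
        _ ≤ _ := setLIntegral_mono' measurableSet_Ioc fun t ht =>
            hf (mem_Ioi.2 (ha.trans_lt ht.1)) (mem_Ioi.2 hah) ht.2
    have hfin2 := hF
    rw [hsplit] at hfin2
    obtain ⟨hl, hr⟩ := ENNReal.add_ne_top.1 hfin2
    have h2 : M + (f (a + h)).toReal * (a + h - a) ≤ (∫⁻ u in Ioc 0 (a + h), f u).toReal := by
      rw [hsplit, ENNReal.toReal_add hl hr]
      have := ENNReal.toReal_mono hr h1
      rw [ENNReal.toReal_mul, ENNReal.toReal_ofReal hh.le] at this
      rw [add_sub_cancel_left]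
      linarith
    refine ⟨by linarith, ENNReal.toReal_nonneg, hu,
      h2.trans (ENNReal.toReal_mono (hφ _ hah) (hle _ hah)), ih _ _ _ hah.le h2 ?_⟩
    exact ENNReal.toReal_mono (hfin _ hah)
      (hf (mem_Ioi.2 hah) (mem_Ioi.2 (by linarith)) (by linarith))

/-- On each interval of the grid, `f` is at most the value of the step function on the preceding
interval; this compensates the shift of the weight by `h`. -/
lemma lintegral_shift_le_stepSum {f : ℝ → ℝ≥0∞} (hf : AntitoneOn f (Ioi 0))
    (hfin : ∀ t, 0 < t → f t ≠ ∞) {s B h : ℝ} (hs : 0 < s) (hB : 0 < B) (hh : 0 < h) (m : ℕ) :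
    ∀ a, 0 ≤ a →
      ∫⁻ t in Ioc (a + h) (a + h + m * h), f t ^ s * ENNReal.ofReal ((t - h) ^ (B - 1)) ≤
        ENNReal.ofReal (stepSum s (fun t => t ^ B / B) a
          (stepList (fun t => (f t).toReal) h a m)) ∧
      0 ≤ stepSum s (fun t => t ^ B / B) a (stepList (fun t => (f t).toReal) h a m) := by
  induction m with
  | zero => intro a _; simp [stepList, stepSum]
  | succ m ih =>
    intro a ha
    have hah : 0 < a + h := by linarith
    obtain ⟨ih1, ih2⟩ := ih (a + h) hah.le
    have hW : 0 ≤ (a + h) ^ B / B - a ^ B / B :=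
      sub_nonneg.2 (by gcongr; linarith)
    have hterm : 0 ≤ (f (a + h)).toReal ^ s * ((a + h) ^ B / B - a ^ B / B) := by positivity
    refine ⟨?_, by simp only [stepList, stepSum]; positivity⟩
    simp only [stepList, stepSum]
    rw [ENNReal.ofReal_add hterm ih2]
    have e : a + h + ((m + 1 : ℕ) : ℝ) * h = a + h + h + m * h := by push_cast; ring
    rw [e, lintegral_Ioc_add (b := a + h + h) (by linarith)
      (by have : 0 ≤ (m : ℝ) * h := by positivity
          linarith)]
    refine add_le_add ?_ ih1
    calc ∫⁻ t in Ioc (a + h) (a + h + h), f t ^ s * ENNReal.ofReal ((t - h) ^ (B - 1))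
        ≤ ∫⁻ t in Ioc (a + h) (a + h + h),
            f (a + h) ^ s * ENNReal.ofReal ((t - h) ^ (B - 1)) := by
          refine setLIntegral_mono' measurableSet_Ioc fun t ht => ?_
          gcongr
          exact hf (mem_Ioi.2 hah) (mem_Ioi.2 (hah.trans ht.1)) ht.1.le
      _ = f (a + h) ^ s * ∫⁻ t in Ioc a (a + h), ENNReal.ofReal (t ^ (B - 1)) := by
          rw [lintegral_const_mul _ (by fun_prop)]
          congr 1
          have := (measurePreserving_sub_right volume h).setLIntegral_comp_preimage
            (s := Ioc a (a + h)) measurableSet_Ioc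
            (f := fun t : ℝ => ENNReal.ofReal (t ^ (B - 1))) (by fun_prop)
          simpa using this
      _ = _ := by
          rw [lintegral_rpow_Ioc (by linarith) ha (by linarith), sub_add_cancel,
            ENNReal.ofReal_mul (by positivity), ← ENNReal.ofReal_rpow_of_nonneg
            ENNReal.toReal_nonneg hs.le, ENNReal.ofReal_toReal (hfin _ hah), sub_div]

/-- If `f` is decreasing and its primitive is at most that of `φ`, then its norm in the space
`L^s` with weight `t ^ (B - 1)` is at most a constant times the norm of `φ`. For `B = s / p` and
`A = s' / p'` the `s`-th root of the constant is `c_{p,s}`. -/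
lemma lintegral_rpow_le_of_primitive_le {s A B : ℝ} (hs : 1 < s) (hA : 0 < A) (hB : 0 < B)
    (hAB : A * (s - 1) + B = s) {f φ : ℝ → ℝ≥0∞} (hf : AntitoneOn f (Ioi 0))
    (hfm : Measurable f) (hφ : Measurable φ)
    (hle : ∀ t, 0 < t → ∫⁻ u in Ioc 0 t, f u ≤ ∫⁻ u in Ioc 0 t, φ u) :
    ∫⁻ t in Ioi 0, f t ^ s * ENNReal.ofReal (t ^ (B - 1)) ≤
      ENNReal.ofReal (A ^ (1 - s) / B) *
        ∫⁻ t in Ioi 0, φ t ^ s * ENNReal.ofReal (t ^ (B - 1)) := by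
  have hs0 : 0 < s := by linarith
  set K := A ^ (1 - s) / B with hK
  have hK0 : 0 < K := by positivity
  set I := ∫⁻ t in Ioi 0, φ t ^ s * ENNReal.ofReal (t ^ (B - 1)) with hI
  rcases eq_or_ne I ∞ with htop | hfinI
  · rw [htop, ENNReal.mul_top (by simpa using hK0)]
    exact le_top
  have hIle : ∀ a b : ℝ, 0 ≤ a →
      ∫⁻ t in Ioc a b, φ t ^ s * ENNReal.ofReal (t ^ (B - 1)) ≤ I := fun a b ha =>
    lintegral_mono_set fun t ht => mem_Ioi.2 (ha.trans_lt ht.1)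
  have hIfin : ∀ a b : ℝ, 0 ≤ a →
      ∫⁻ t in Ioc a b, φ t ^ s * ENNReal.ofReal (t ^ (B - 1)) ≠ ∞ := fun a b ha =>
    ne_top_of_le_ne_top hfinI (hIle a b ha)
  have hφfin : ∀ t, 0 ≤ t → ∫⁻ u in Ioc 0 t, φ u ≠ ∞ := fun t ht => by
    have := hIfin 0 t le_rfl
    have h0 : 0 ≤ 1 / s := by positivity
    have h1 : 0 ≤ (s - 1) / s := div_nonneg (by linarith) hs0.le
    exact ne_top_of_le_ne_top (ENNReal.mul_ne_top (ENNReal.rpow_ne_top_of_nonneg h0 this)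
      (ENNReal.rpow_ne_top_of_nonneg h1 ENNReal.ofReal_ne_top))
      (lintegral_Ioc_le_weighted hs hA hAB le_rfl ht hφ)
  have hffin : ∀ t, 0 < t → f t ≠ ∞ := by
    intro t ht htop
    refine hφfin t ht.le (top_le_iff.1 (le_trans ?_ (hle t ht)))
    calc ∞ = ∫⁻ _ in Ioc 0 t, (∞ : ℝ≥0∞) := by simp [ht]
      _ ≤ _ := setLIntegral_mono' measurableSet_Ioc fun u hu => by
          rw [← htop]; exact hf (mem_Ioi.2 hu.1) (mem_Ioi.2 ht) hu.2
  -- the step functions, by the inequality for lists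
  have hstep : ∀ (h : ℝ) (m : ℕ), 0 < h →
      ∫⁻ t in Ioc h (h + m * h), f t ^ s * ENNReal.ofReal ((t - h) ^ (B - 1)) ≤
        ENNReal.ofReal K * I := by
    intro h m hh
    have h1 := (lintegral_shift_le_stepSum hf hffin hs0 hB hh m 0 le_rfl).1
    rw [zero_add] at h1
    refine h1.trans ?_
    have hadm := stepAdmissible_stepList hf (fun t ht => hφfin t ht.le) hle hffin hh m 0 0 _ le_rfl
      (by simp) le_rfl
    have h2 := stepSum_le hs.le (Φ := fun t => (∫⁻ u in Ioc 0 t, φ u).toReal)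
      (W := fun t => t ^ B / B)
      (Ψ := fun t => K * (∫⁻ u in Ioc 0 t, φ u ^ s * ENNReal.ofReal (u ^ (B - 1))).toReal)
      (fun x hx y _ hxy => by
        have : 0 ≤ x := hx
        dsimp only
        gcongr)
      (fun x _ y _ hxy => by
        dsimp only
        gcongr
        exact hIfin 0 y le_rfl)
      (fun a b v ha hab hv hvle => by
        have hb : 0 ≤ b := ha.trans hab.le
        have h3 := hφfin b hb
        have h4 := hIfin 0 b le_rfl
        rw [lintegral_Ioc_add ha hab.le] at h3 h4
        obtain ⟨h3a, h3b⟩ := ENNReal.add_ne_top.1 h3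
        obtain ⟨h4a, h4b⟩ := ENNReal.add_ne_top.1 h4
        rw [lintegral_Ioc_add ha hab.le, ENNReal.toReal_add h3a h3b, add_sub_cancel_left] at hvle
        rw [lintegral_Ioc_add ha hab.le, ENNReal.toReal_add h4a h4b, ← sub_div, mul_add,
          add_sub_cancel_left]
        exact rpow_mul_sub_le hs hA hB hAB ha hab hv hφ h4b hvle)
      m (stepList (fun t => (f t).toReal) h 0 m)
      (length_stepList _ _ _ _).le
      0 _ le_rfl (by simpa using hadm)
    rw [stepEnd_stepList] at h2
    simp only [Ioc_self, Measure.restrict_empty, lintegral_zero_measure, ENNReal.toReal_zero,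
      mul_zero, sub_zero] at h2
    refine (ENNReal.ofReal_le_ofReal h2).trans ?_
    rw [ENNReal.ofReal_mul hK0.le, ENNReal.ofReal_toReal (hIfin _ _ le_rfl)]
    gcongr
    exact hIle _ _ le_rfl
  -- Fatou's lemma as the mesh `1 / (n + 1)` tends to zero
  set F : ℕ → ℝ → ℝ≥0∞ := fun n =>
    (Ioc (1 / ((n : ℝ) + 1)) (1 / ((n : ℝ) + 1) + ((n : ℝ) + 1))).indicator
      fun t => f t ^ s * ENNReal.ofReal ((t - 1 / ((n : ℝ) + 1)) ^ (B - 1)) with hF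
  have hFm : ∀ n, Measurable (F n) := fun n =>
    Measurable.indicator (by fun_prop) measurableSet_Ioc
  have hFint : ∀ n, ∫⁻ t in Ioi 0, F n t ≤ ENNReal.ofReal K * I := by
    intro n
    have hn : 0 < (n : ℝ) + 1 := by positivity
    have := hstep (1 / ((n : ℝ) + 1)) ((n + 1) ^ 2) (by positivity)
    have e : (((n + 1) ^ 2 : ℕ) : ℝ) * (1 / ((n : ℝ) + 1)) = n + 1 := by
      push_cast; field_simp
    rw [e] at this
    refine le_trans ?_ this
    rw [← lintegral_indicator measurableSet_Ioc]
    exact setLIntegral_le_lintegral _ _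
  have hlim : ∀ t ∈ Ioi (0 : ℝ), f t ^ s * ENNReal.ofReal (t ^ (B - 1)) =
      liminf (fun n => F n t) atTop := by
    intro t ht
    have ht : 0 < t := ht
    refine (Tendsto.liminf_eq ?_).symm
    have h1 : Tendsto (fun n : ℕ => 1 / ((n : ℝ) + 1)) atTop (𝓝 0) :=
      tendsto_one_div_add_atTop_nhds_zero_nat
    have h2 : Tendsto (fun n : ℕ => f t ^ s * ENNReal.ofReal ((t - 1 / ((n : ℝ) + 1)) ^ (B - 1)))
        atTop (𝓝 (f t ^ s * ENNReal.ofReal (t ^ (B - 1)))) := by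
      refine ENNReal.Tendsto.const_mul ?_ (Or.inr (ENNReal.rpow_ne_top_of_nonneg hs0.le
        (hffin t ht)))
      refine ENNReal.tendsto_ofReal (Tendsto.rpow_const ?_ (Or.inl ht.ne'))
      simpa using tendsto_const_nhds.sub h1
    refine h2.congr' ?_
    filter_upwards [h1.eventually_lt_const ht,
      tendsto_natCast_atTop_atTop.eventually_ge_atTop t] with n hn1 hn2
    simp only [hF]
    rw [indicator_of_mem]
    refine ⟨hn1, ?_⟩
    have : 0 < 1 / ((n : ℝ) + 1) := by positivity
    linarith
  calc ∫⁻ t in Ioi 0, f t ^ s * ENNReal.ofReal (t ^ (B - 1))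
      = ∫⁻ t in Ioi 0, liminf (fun n => F n t) atTop :=
        setLIntegral_congr_fun measurableSet_Ioi hlim
    _ ≤ liminf (fun n => ∫⁻ t in Ioi 0, F n t) atTop := lintegral_liminf_le hFm
    _ ≤ ENNReal.ofReal K * I := by
        refine (liminf_le_liminf (Eventually.of_forall hFint)).trans ?_
        simp

/-! ### The triangle inequality with the sharp constant -/

lemma one_lt_toReal {p : ℝ≥0∞} (hp : 1 < p) (hp' : p ≠ ∞) : 1 < p.toReal := by
  rw [← ENNReal.toReal_one]
  exact (ENNReal.toReal_lt_toReal ENNReal.one_ne_top hp').2 hp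

lemma conjExponent_eq_ofReal {p : ℝ≥0∞} (hp : 1 < p) (hp' : p ≠ ∞) :
    p.conjExponent = ENNReal.ofReal (p.toReal / (p.toReal - 1)) := by
  have h1 := one_lt_toReal hp hp'
  have h2 : 0 < p.toReal - 1 := by linarith
  have e : p - 1 = ENNReal.ofReal (p.toReal - 1) := by
    rw [ENNReal.ofReal_sub _ zero_le_one, ENNReal.ofReal_toReal hp', ENNReal.ofReal_one]
  rw [ENNReal.conjExponent, e, ← ENNReal.ofReal_inv_of_pos h2, ← ENNReal.ofReal_one,
    ← ENNReal.ofReal_add zero_le_one (by positivity)]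
  congr 1
  field_simp
  ring

lemma sharpConstant_top {p : ℝ≥0∞} (hp : 1 < p) (hp' : p ≠ ∞) :
    sharpConstant p ∞ = ENNReal.ofReal (1 - 1 / p.toReal)⁻¹ := by
  have h1 := one_lt_toReal hp hp'
  have h2 : p.toReal - 1 ≠ 0 := by linarith
  have h3 : (∞ : ℝ≥0∞).conjExponent = 1 := by simp [ENNReal.conjExponent]
  simp only [sharpConstant, h3, conjExponent_eq_ofReal hp hp', ENNReal.toReal_top, div_zero,
    ENNReal.rpow_zero, ENNReal.toReal_one, div_one, ENNReal.rpow_one, one_mul]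
  congr 1
  field_simp

lemma sharpConstant_of_ne_top {p s : ℝ≥0∞} (hp : 1 < p) (hps : p < s) (hs : s ≠ ∞) {A B : ℝ}
    (hB : B = s.toReal / p.toReal) (hA : A = (s.toReal - B) / (s.toReal - 1)) :
    sharpConstant p s =
      ENNReal.ofReal (B⁻¹ ^ (1 / s.toReal) * A⁻¹ ^ ((s.toReal - 1) / s.toReal)) := by
  have hp' : p ≠ ∞ := hps.ne_top
  have h1 := one_lt_toReal hp hp'
  have h2 := one_lt_toReal (hp.trans hps) hs
  have h3 : 0 < p.toReal - 1 := by linarith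
  have h4 : 0 < s.toReal - 1 := by linarith
  have h5 : 0 < p.toReal := by linarith
  have h6 : 0 < s.toReal := by linarith
  have eB : B⁻¹ = p.toReal / s.toReal := by rw [hB, inv_div]
  have eA : A⁻¹ = p.toReal / (p.toReal - 1) / (s.toReal / (s.toReal - 1)) := by
    rw [hA, hB, inv_div]
    field_simp
  have e1 : p / s = ENNReal.ofReal B⁻¹ := by
    rw [eB, ENNReal.ofReal_div_of_pos h6, ENNReal.ofReal_toReal hp', ENNReal.ofReal_toReal hs]
  have hB0 : 0 ≤ B⁻¹ := by rw [eB]; positivity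
  have hA0 : 0 ≤ A⁻¹ := by rw [eA]; positivity
  rw [sharpConstant, conjExponent_eq_ofReal hp hp', conjExponent_eq_ofReal (hp.trans hps) hs,
    ← ENNReal.ofReal_div_of_pos (by positivity), ENNReal.toReal_ofReal (by positivity), ← eA, e1,
    one_div_div, ENNReal.ofReal_mul (by positivity),
    ENNReal.ofReal_rpow_of_nonneg hB0 (by positivity),
    ENNReal.ofReal_rpow_of_nonneg hA0 (by positivity)]

lemma sharpConstant_ne_top {p s : ℝ≥0∞} (hp : 1 < p) (hps : p < s) : sharpConstant p s ≠ ∞ := by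
  rcases eq_or_ne s ∞ with rfl | hs
  · rw [sharpConstant_top hp hps.ne_top]
    exact ENNReal.ofReal_ne_top
  · rw [sharpConstant_of_ne_top hp hps hs rfl rfl]
    exact ENNReal.ofReal_ne_top

lemma lintegral_lorentz_eq (h : ℝ → ℝ≥0∞) {P S : ℝ} (hS : 0 < S) :
    ∫⁻ t in Ioi (0 : ℝ), (ENNReal.ofReal t ^ (1 / P) * h t) ^ S / ENNReal.ofReal t =
      ∫⁻ t in Ioi (0 : ℝ), h t ^ S * ENNReal.ofReal (t ^ (S / P - 1)) := by
  refine setLIntegral_congr_fun measurableSet_Ioi fun t ht => ?_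
  have ht : 0 < t := ht
  rw [ENNReal.mul_rpow_of_nonneg _ _ hS.le, ENNReal.ofReal_rpow_of_pos ht,
    ENNReal.ofReal_rpow_of_pos (by positivity), ← Real.rpow_mul ht.le, mul_comm, mul_div_assoc,
    ← ENNReal.ofReal_div_of_pos ht, one_div_mul_eq_div, Real.rpow_sub_one ht.ne']

lemma lorentzNorm_of_ne_top {p s : ℝ≥0∞} (hs0 : 0 < s.toReal) (hs : s ≠ ∞) (μ : Measure R)
    (f : R → 𝕜) :
    lorentzNorm p s μ f = (∫⁻ t in Ioi (0 : ℝ), rearrangement μ f t ^ s.toReal *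
      ENNReal.ofReal (t ^ (s.toReal / p.toReal - 1))) ^ (1 / s.toReal) := by
  rw [lorentzNorm, if_neg hs, lintegral_lorentz_eq _ hs0]

/-- Minkowski's inequality for finite sums of functions with values in `[0,∞]`. -/
lemma lintegral_Lp_finset_sum_le {α ι : Type*} [MeasurableSpace α] (ν : Measure α) {S : ℝ}
    (hS : 1 ≤ S) (J : Finset ι) {g : ι → α → ℝ≥0∞} (hg : ∀ i, Measurable (g i)) :
    (∫⁻ x, (∑ i ∈ J, g i x) ^ S ∂ν) ^ (1 / S) ≤ ∑ i ∈ J, (∫⁻ x, g i x ^ S ∂ν) ^ (1 / S) := by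
  classical
  have hS0 : 0 < S := by linarith
  induction J using Finset.induction_on with
  | empty => simp [hS0]
  | insert i J hi ih =>
    simp_rw [Finset.sum_insert hi]
    refine le_trans ?_ (add_le_add le_rfl ih)
    exact ENNReal.lintegral_Lp_add_le (f := g i) (g := fun x => ∑ i ∈ J, g i x)
      (hg i).aemeasurable (by fun_prop) hS

lemma triangleInequality_of_ne_top {μ : Measure R} [SFinite μ] {p s : ℝ≥0∞} (hp : 1 < p)
    (hps : p < s) (hs : s ≠ ∞) : TriangleInequality 𝕜 p s μ (sharpConstant p s) := by
  intro N f hf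
  have hp' : p ≠ ∞ := hps.ne_top
  have h1 := one_lt_toReal hp hp'
  have h2 := one_lt_toReal (hp.trans hps) hs
  have h3 : p.toReal < s.toReal := (ENNReal.toReal_lt_toReal hp' hs).2 hps
  set S := s.toReal with hS
  set B := S / p.toReal with hB
  set A := (S - B) / (S - 1) with hA
  have hS0 : 0 < S := by linarith
  have hS1 : 0 < S - 1 := by linarith
  have hB0 : 0 < B := by positivity
  have hBS : B < S := div_lt_self hS0 h1
  have hA0 : 0 < A := div_pos (by linarith) hS1
  have hAB : A * (S - 1) + B = S := by rw [hA, div_mul_cancel₀ _ hS1.ne']; ring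
  have hc : sharpConstant p s = ENNReal.ofReal (A ^ (1 - S) / B) ^ (1 / S) := by
    rw [sharpConstant_of_ne_top hp hps hs hB hA, ENNReal.ofReal_rpow_of_nonneg (by positivity)
      (by positivity), ← hS, div_eq_mul_inv (A ^ (1 - S)) B,
      Real.mul_rpow (by positivity) (by positivity),
      ← Real.rpow_mul hA0.le, mul_comm, Real.inv_rpow hA0.le, ← Real.rpow_neg hA0.le]
    congr 3
    ring
  rw [hc]
  simp_rw [lorentzNorm_of_ne_top hS0 hs]
  have hmeas : ∀ k, Measurable (rearrangement μ (f k)) := fun k => measurable_rearrangement _ _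
  have key := lintegral_rpow_le_of_primitive_le h2 hA0 hB0 hAB
    ((rearrangement_antitone μ fun x => ∑ k, f k x).antitoneOn _) (measurable_rearrangement _ _)
    (φ := fun t => ∑ k, rearrangement μ (f k) t) (by fun_prop)
    fun t ht => lintegral_rearrangement_sum_le (fun k => (hf k).1) ht.le
  refine (ENNReal.rpow_le_rpow key (by positivity)).trans ?_
  rw [ENNReal.mul_rpow_of_nonneg _ _ (by positivity)]
  gcongr
  have hmink := lintegral_Lp_finset_sum_le
    ((volume.restrict (Ioi (0 : ℝ))).withDensity fun t => ENNReal.ofReal (t ^ (B - 1))) h2.le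
    Finset.univ hmeas
  simp_rw [lintegral_withDensity_eq_lintegral_mul (volume.restrict (Ioi (0 : ℝ)))
    (show Measurable fun t : ℝ => ENNReal.ofReal (t ^ (B - 1)) by fun_prop)
    ((hmeas _).pow_const S)] at hmink
  rw [lintegral_withDensity_eq_lintegral_mul (volume.restrict (Ioi (0 : ℝ)))
    (show Measurable fun t : ℝ => ENNReal.ofReal (t ^ (B - 1)) by fun_prop) (by fun_prop)] at hmink
  simpa only [Pi.mul_apply, mul_comm] using hmink

lemma triangleInequality_top {μ : Measure R} [SFinite μ] {p : ℝ≥0∞} (hp : 1 < p) (hp' : p ≠ ∞) :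
    TriangleInequality 𝕜 p ∞ μ (sharpConstant p ∞) := by
  intro N f hf
  have h1 := one_lt_toReal hp hp'
  rw [sharpConstant_top hp hp']
  set γ := 1 / p.toReal with hγ
  have hγ1 : γ < 1 := by rw [hγ, div_lt_one (by linarith)]; exact h1
  have hγ0 : 0 < 1 - γ := by linarith
  simp only [lorentzNorm, if_true, ← hγ]
  refine iSup₂_le fun t ht => ?_
  set M : Fin N → ℝ≥0∞ := fun k => ⨆ (t : ℝ) (_ : 0 < t), ENNReal.ofReal t ^ γ *
    rearrangement μ (f k) t with hM
  have hb : ∀ k u, 0 < u → rearrangement μ (f k) u ≤ M k * ENNReal.ofReal (u ^ (-γ)) := by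
    intro k u hu
    calc rearrangement μ (f k) u
        = ENNReal.ofReal u ^ γ * rearrangement μ (f k) u * ENNReal.ofReal (u ^ (-γ)) := by
          rw [mul_right_comm, ENNReal.ofReal_rpow_of_pos hu, ← ENNReal.ofReal_mul (by positivity),
            ← Real.rpow_add hu]
          simp
      _ ≤ _ := by
          gcongr
          exact le_iSup₂ (f := fun (t : ℝ) (_ : 0 < t) => ENNReal.ofReal t ^ γ *
            rearrangement μ (f k) t) u hu
  set F := fun x => ∑ k, f k x with hF
  have hint : rearrangement μ F t * ENNReal.ofReal t ≤
      (∑ k, M k) * ENNReal.ofReal (t ^ (1 - γ) / (1 - γ)) := by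
    calc rearrangement μ F t * ENNReal.ofReal t
        = ∫⁻ _ in Ioc 0 t, rearrangement μ F t := by simp
      _ ≤ ∫⁻ u in Ioc 0 t, rearrangement μ F u :=
          setLIntegral_mono' measurableSet_Ioc fun u hu => rearrangement_antitone μ F hu.2
      _ ≤ ∫⁻ u in Ioc 0 t, ∑ k, rearrangement μ (f k) u :=
          lintegral_rearrangement_sum_le (fun k => (hf k).1) ht.le
      _ ≤ ∫⁻ u in Ioc 0 t, (∑ k, M k) * ENNReal.ofReal (u ^ (-γ)) := by
          refine setLIntegral_mono' measurableSet_Ioc fun u hu => ?_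
          rw [Finset.sum_mul]
          exact Finset.sum_le_sum fun k _ => hb k u hu.1
      _ = _ := by
          rw [lintegral_const_mul _ (by fun_prop), lintegral_rpow_Ioc (by linarith) le_rfl ht.le,
            show -γ + 1 = 1 - γ by ring, Real.zero_rpow hγ0.ne', sub_zero]
  calc ENNReal.ofReal t ^ γ * rearrangement μ F t
      = ENNReal.ofReal (t ^ (γ - 1)) * (rearrangement μ F t * ENNReal.ofReal t) := by
        rw [ENNReal.ofReal_rpow_of_pos ht, mul_left_comm, ← ENNReal.ofReal_mul (by positivity),
          mul_comm, ← Real.rpow_add_one ht.ne', sub_add_cancel]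
    _ ≤ ENNReal.ofReal (t ^ (γ - 1)) *
          ((∑ k, M k) * ENNReal.ofReal (t ^ (1 - γ) / (1 - γ))) := by gcongr
    _ = _ := by
        rw [mul_left_comm, ← ENNReal.ofReal_mul (by positivity), mul_comm, ← mul_div_assoc,
          ← Real.rpow_add ht]
        simp

/-- The triangle inequality holds with the constant `c_{p,s}`. -/
lemma triangleInequality_sharpConstant {μ : Measure R} [SFinite μ] {p s : ℝ≥0∞} (hp : 1 < p)
    (hps : p < s) : TriangleInequality 𝕜 p s μ (sharpConstant p s) := by
  rcases eq_or_ne s ∞ with rfl | hs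
  · exact triangleInequality_top hp hps.ne_top
  · exact triangleInequality_of_ne_top hp hps hs

/-! ### The decomposition norm -/

lemma decompositionNorm_le {p s : ℝ≥0∞} {μ : Measure R} {f : R → 𝕜} {N : ℕ}
    {g : Fin N → R → 𝕜} (hg : ∀ k, MemLorentz p s μ (g k))
    (hfg : f =ᵐ[μ] fun x => ∑ k, g k x) :
    decompositionNorm p s μ f ≤ ∑ k, lorentzNorm p s μ (g k) :=
  iInf_le_of_le N <| iInf_le_of_le g <| iInf_le_of_le hg <| iInf_le_of_le hfg le_rfl

lemma TriangleInequality.decompositionInequality {p s : ℝ≥0∞} {μ : Measure R} {C : ℝ≥0∞}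
    (hC : C ≠ ∞) (h : TriangleInequality 𝕜 p s μ C) : DecompositionInequality 𝕜 p s μ C := by
  intro f hf
  rcases eq_or_ne C 0 with rfl | hC0
  · simpa using h 1 (fun _ => f) fun _ => hf
  simp only [decompositionNorm, ENNReal.mul_iInf_of_ne hC0 hC]
  refine le_iInf fun N => le_iInf fun g => le_iInf fun hg => le_iInf fun hfg => ?_
  rw [lorentzNorm_congr_ae hfg]
  exact h N g hg

lemma triangleInequality_iff_decompositionInequality {p s : ℝ≥0∞} {μ : Measure R} [SFinite μ]
    (hp : 1 < p) (hps : p < s) (C : ℝ≥0∞) :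
    TriangleInequality 𝕜 p s μ C ↔ DecompositionInequality 𝕜 p s μ C := by
  have h0 := triangleInequality_sharpConstant (𝕜 := 𝕜) (μ := μ) hp hps
  constructor
  · intro h
    rcases eq_or_ne C ∞ with rfl | hC
    -- for `C = ∞` only functions with vanishing decomposition norm matter (`∞ * 0 = 0`)
    · intro f hf
      have h1 := h0.decompositionInequality (sharpConstant_ne_top hp hps) f hf
      rcases eq_or_ne (decompositionNorm p s μ f) 0 with hd | hd
      · simpa [hd] using h1
      · simp [ENNReal.top_mul hd]
    · exact h.decompositionInequality hC
  · intro h N f hf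
    have hmem : MemLorentz p s μ fun x => ∑ k, f k x :=
      ⟨Finset.aestronglyMeasurable_fun_sum _ fun k _ => (hf k).1,
        (h0 N f hf).trans_lt (ENNReal.mul_lt_top (sharpConstant_ne_top hp hps).lt_top
          (ENNReal.sum_lt_top.2 fun k _ => (hf k).2))⟩
    refine (h _ hmem).trans ?_
    gcongr
    exact decompositionNorm_le hf ae_eq_rfl

/-! ### Decompositions of an indicator function into equimeasurable pieces -/

/-- The set `E` has measure `a` and contains, for every `n > 0`, `n` disjoint sets of measure
`a / n`. -/
def HasEqualPartitions (μ : Measure R) (E : Set R) (a : ℝ) : Prop :=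
  MeasurableSet E ∧ μ E = ENNReal.ofReal a ∧ ∀ n : ℕ, 0 < n → ∃ D : Fin n → Set R,
    (∀ j, MeasurableSet (D j)) ∧ Pairwise (Function.onFun Disjoint D) ∧ (∀ j, D j ⊆ E) ∧
      ∀ j, μ (D j) = ENNReal.ofReal (a / n)

lemma card_filter_add_one_le (n : ℕ) {r : ℝ} (hr : 0 ≤ r) :
    ((Finset.univ.filter fun i : Fin n => ((i : ℕ) : ℝ) + 1 ≤ r).card : ℝ) ≤ r := by
  have : (Finset.univ.filter fun i : Fin n => ((i : ℕ) : ℝ) + 1 ≤ r).card ≤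
      (Finset.range ⌊r⌋₊).card := by
    refine Finset.card_le_card_of_injOn (fun i => (i : ℕ)) (fun i hi => ?_)
      (fun i _ j _ h => Fin.ext h)
    have hi : ((i : ℕ) : ℝ) + 1 ≤ r := by simpa using hi
    have : (i : ℕ) + 1 ≤ ⌊r⌋₊ := Nat.le_floor (by push_cast; exact hi)
    simpa using this
  rw [Finset.card_range] at this
  exact (Nat.cast_le.2 this).trans (Nat.floor_le hr)

/-- The indicator of `E` is the sum of `n` functions with a common distribution. They take
normalized values of `t ^ (-γ)` on `n` pieces of `E` of equal measure, and arise from each other by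
cyclic permutations of the pieces. -/
lemma exists_cyclic_decomposition {μ : Measure R} {E : Set R} {a γ : ℝ} (ha : 0 < a) (hγ : 0 ≤ γ)
    (hE : HasEqualPartitions μ E a) (N : ℕ) {S : ℝ}
    (hS : S = ∑ i : Fin (N + 1), (a * ((i : ℕ) + 1) / (N + 1 : ℕ)) ^ (-γ)) :
    ∃ g : Fin (N + 1) → R → 𝕜, (∀ k, AEStronglyMeasurable (g k) μ) ∧
      (E.indicator fun _ => (1 : 𝕜)) =ᵐ[μ] (fun x => ∑ k, g k x) ∧
      ∀ k t, 0 < t → rearrangement μ (g k) t ≤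
        (Iio a).indicator (fun t => ENNReal.ofReal (t ^ (-γ) / S)) t := by
  obtain ⟨hEm, hEa, hpart⟩ := hE
  obtain ⟨D, hDm, hDd, hDE, hDa⟩ := hpart (N + 1) N.succ_pos
  have hn : (0 : ℝ) < (N + 1 : ℕ) := by positivity
  have hS0 : 0 < S := by
    rw [hS]
    exact Finset.sum_pos (fun i _ => by positivity) ⟨0, Finset.mem_univ _⟩
  -- the values of the pieces, normalized to have sum `1`; addition in `Fin (N + 1)` is cyclic
  set b : Fin (N + 1) → ℝ := fun i => (a * ((i : ℕ) + 1) / (N + 1 : ℕ)) ^ (-γ) / S with hb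
  have hb0 : ∀ i, 0 < b i := fun i => by rw [hb]; positivity
  have hbsum : ∑ i, b i = 1 := by
    rw [hb, ← Finset.sum_div, ← hS, div_self hS0.ne']
  set g : Fin (N + 1) → R → 𝕜 := fun k x => ∑ j, (D j).indicator (fun _ => ((b (j + k) : ℝ) : 𝕜)) x
    with hg
  have hval : ∀ k j x, x ∈ D j → g k x = ((b (j + k) : ℝ) : 𝕜) := by
    intro k j x hx
    simp only [hg]
    rw [Finset.sum_eq_single j, indicator_of_mem hx]
    · intro i _ hij
      exact indicator_of_notMem (fun hi => (hDd hij).notMem_of_mem_left hi hx) _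
    · simp
  have hval0 : ∀ k x, (∀ j, x ∉ D j) → g k x = 0 := by
    intro k x hx
    simp only [hg]
    exact Finset.sum_eq_zero fun j _ => indicator_of_notMem (hx j) _
  have hUE : (⋃ j, D j) =ᵐ[μ] E := by
    refine ae_eq_of_subset_of_measure_ge (iUnion_subset hDE) ?_
      (MeasurableSet.iUnion hDm).nullMeasurableSet (by rw [hEa]; exact ENNReal.ofReal_ne_top)
    rw [measure_iUnion hDd hDm, tsum_fintype]
    simp only [hDa, Finset.sum_const, Finset.card_univ, Fintype.card_fin, nsmul_eq_mul]
    rw [← ENNReal.ofReal_natCast, ← ENNReal.ofReal_mul hn.le, mul_div_cancel₀ _ hn.ne', hEa]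
  have hdist : ∀ k (y : ℝ≥0∞) (r : ℝ), 0 ≤ r → (∀ i, y < ENNReal.ofReal (b i) →
      ((i : ℕ) : ℝ) + 1 ≤ r) → distribution μ (g k) y ≤ ENNReal.ofReal (r * (a / (N + 1 : ℕ))) := by
    intro k y r hr hy
    set J := Finset.univ.filter fun j : Fin (N + 1) => (((j + k : Fin (N + 1)) : ℕ) : ℝ) + 1 ≤ r
      with hJ
    have hsub : {x | y < ‖g k x‖ₑ} ⊆ ⋃ j ∈ J, D j := by
      intro x hx
      have hx : y < ‖g k x‖ₑ := hx
      by_cases hxD : ∃ j, x ∈ D j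
      · obtain ⟨j, hj⟩ := hxD
        rw [hval k j x hj, ← ofReal_norm, RCLike.norm_ofReal, abs_of_pos (hb0 _)] at hx
        exact mem_iUnion₂.2 ⟨j, by simpa [hJ] using hy _ hx, hj⟩
      · rw [hval0 k x (not_exists.1 hxD)] at hx
        simp at hx
    have hcard : (J.card : ℝ) ≤ r := by
      refine le_trans (le_of_eq ?_) (card_filter_add_one_le (N + 1) hr)
      norm_cast
      exact Finset.card_equiv (Equiv.addRight k) fun j => by simp [hJ]
    calc distribution μ (g k) y ≤ μ (⋃ j ∈ J, D j) := measure_mono hsub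
      _ ≤ ∑ j ∈ J, μ (D j) := measure_biUnion_finset_le _ _
      _ = ENNReal.ofReal (J.card * (a / (N + 1 : ℕ))) := by
          simp only [hDa, Finset.sum_const, nsmul_eq_mul]
          rw [← ENNReal.ofReal_natCast, ← ENNReal.ofReal_mul (by positivity)]
      _ ≤ _ := ENNReal.ofReal_le_ofReal (by gcongr)
  refine ⟨g, fun k => ?_, ?_, fun k t ht => ?_⟩
  · exact Finset.aestronglyMeasurable_fun_sum _ fun j _ =>
      aestronglyMeasurable_const.indicator (hDm j)
  · refine (indicator_ae_eq_of_ae_eq_set hUE.symm).trans (Eventually.of_forall fun x => ?_)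
    simp only
    by_cases hxD : ∃ j, x ∈ D j
    · obtain ⟨j, hj⟩ := hxD
      have hshift : ∑ k, b (j + k) = 1 := (Equiv.sum_comp (Equiv.addLeft j) b).trans hbsum
      rw [indicator_of_mem (mem_iUnion.2 ⟨j, hj⟩), Finset.sum_congr rfl fun k _ => hval k j x hj,
        ← RCLike.ofReal_sum, hshift, RCLike.ofReal_one]
    · rw [indicator_of_notMem (by simpa using hxD), Finset.sum_eq_zero fun k _ =>
        hval0 k x (not_exists.1 hxD)]
  · by_cases hta : t < a
    · rw [indicator_of_mem (mem_Iio.2 hta)]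
      refine sInf_le ((hdist k _ (t / (a / (N + 1 : ℕ))) (by positivity) fun i hi => ?_).trans ?_)
      · rw [le_div_iff₀ (by positivity)]
        by_contra! hc
        refine hi.not_ge (ENNReal.ofReal_le_ofReal (div_le_div_of_nonneg_right ?_ hS0.le))
        refine Real.rpow_le_rpow_of_nonpos ht (hc.le.trans (le_of_eq ?_)) (by linarith)
        ring
      · rw [div_mul_cancel₀ _ (by positivity)]
    · rw [indicator_of_notMem (by simpa using hta)]
      refine sInf_le ((hdist k 0 (N + 1 : ℕ) (by positivity) fun i _ => ?_).trans ?_)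
      · exact_mod_cast i.2
      · rw [mul_div_cancel₀ _ hn.ne']
        exact ENNReal.ofReal_le_ofReal (not_lt.1 hta)

/-- A lower bound for the Riemann sum of the decreasing function `t ^ (A - 1)` on `(0,a)`. -/
lemma rpow_sub_rpow_le_sum {a A : ℝ} (ha : 0 < a) (hA : 0 < A) (hA1 : A ≤ 1) (N : ℕ) :
    (a ^ A - (a / (N + 1 : ℕ)) ^ A) / A ≤ a / (N + 1 : ℕ) *
      ∑ i : Fin (N + 1), (a * ((i : ℕ) + 1) / (N + 1 : ℕ)) ^ (-(1 - A)) := by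
  have hn : (0 : ℝ) < (N + 1 : ℕ) := by positivity
  set h := a / (N + 1 : ℕ) with hh
  have hh0 : 0 < h := by positivity
  have hstep : ∀ i : ℕ, ((h * (i + 1 + 1)) ^ A - (h * (i + 1)) ^ A) / A ≤
      h * (h * (i + 1)) ^ (-(1 - A)) := by
    intro i
    set x := h * ((i : ℝ) + 1) with hx
    have hx0 : 0 < x := by positivity
    have e : h * ((i : ℝ) + 1 + 1) = x * (1 + h / x) := by rw [hx]; field_simp
    have hq : 0 ≤ h / x := by positivity
    have hbern := rpow_one_add_le_one_add_mul_self (s := h / x) (by linarith) hA.le hA1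
    rw [e, Real.mul_rpow hx0.le (by positivity), div_le_iff₀ hA, neg_sub, Real.rpow_sub_one hx0.ne']
    calc x ^ A * (1 + h / x) ^ A - x ^ A ≤ x ^ A * (1 + A * (h / x)) - x ^ A := by gcongr
      _ = _ := by ring
  calc (a ^ A - h ^ A) / A
      ≤ ((h * ((N + 1 : ℕ) + 1)) ^ A - h ^ A) / A := by
        gcongr
        rw [hh, mul_add, div_mul_cancel₀ _ hn.ne']
        linarith
    _ = ∑ i ∈ Finset.range (N + 1), ((h * (i + 1 + 1)) ^ A - (h * (i + 1)) ^ A) / A := by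
        rw [← Finset.sum_div]
        have := Finset.sum_range_sub (fun i : ℕ => (h * ((i : ℝ) + 1)) ^ A) (N + 1)
        push_cast at this ⊢
        rw [this]
        simp
    _ ≤ ∑ i ∈ Finset.range (N + 1), h * (h * (i + 1)) ^ (-(1 - A)) :=
        Finset.sum_le_sum fun i _ => hstep i
    _ = _ := by
        rw [← Finset.mul_sum, Finset.sum_range]
        congr 2 with i
        rw [hh]
        congr 1
        ring

/-- A bound for the decomposition norm of an indicator function. Here `K` is the Lorentz norm of
the function `t ^ (-γ)` on `(0,a)`. -/
lemma decompositionNorm_indicator_le {p s : ℝ≥0∞} {μ : Measure R} {E : Set R} {a γ K : ℝ}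
    (ha : 0 < a) (hγ : 0 ≤ γ) (hγ1 : γ < 1) (hK : 0 ≤ K) (hE : HasEqualPartitions μ E a)
    (hnorm : ∀ (g : R → 𝕜) (S : ℝ), 0 < S → (∀ t, 0 < t → rearrangement μ g t ≤
      (Iio a).indicator (fun t => ENNReal.ofReal (t ^ (-γ) / S)) t) →
      lorentzNorm p s μ g ≤ ENNReal.ofReal (K / S)) :
    decompositionNorm p s μ (E.indicator fun _ => (1 : 𝕜)) ≤
      ENNReal.ofReal (K * (1 - γ) * a ^ γ) ∧
    ∃ g : Fin 1 → R → 𝕜, (∀ k, MemLorentz p s μ (g k)) ∧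
      (E.indicator fun _ => (1 : 𝕜)) =ᵐ[μ] fun x => ∑ k, g k x := by
  have hA : 0 < 1 - γ := by linarith
  have hdec : ∀ (N : ℕ) (S : ℝ),
      S = ∑ i : Fin (N + 1), (a * ((i : ℕ) + 1) / (N + 1 : ℕ)) ^ (-γ) → 0 < S ∧
      ∃ g : Fin (N + 1) → R → 𝕜, (∀ k, MemLorentz p s μ (g k)) ∧
        (E.indicator fun _ => (1 : 𝕜)) =ᵐ[μ] (fun x => ∑ k, g k x) ∧
        ∀ k, lorentzNorm p s μ (g k) ≤ ENNReal.ofReal (K / S) := by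
    intro N S hS
    have hS0 : 0 < S := by
      rw [hS]
      exact Finset.sum_pos (fun i _ => by positivity) ⟨0, Finset.mem_univ _⟩
    obtain ⟨g, hg1, hg2, hg3⟩ := exists_cyclic_decomposition (𝕜 := 𝕜) ha hγ hE N hS
    have hle : ∀ k, lorentzNorm p s μ (g k) ≤ ENNReal.ofReal (K / S) :=
      fun k => hnorm (g k) S hS0 (hg3 k)
    exact ⟨hS0, g, fun k => ⟨hg1 k, (hle k).trans_lt ENNReal.ofReal_lt_top⟩, hg2, hle⟩
  constructor
  -- the Riemann sums of `t ^ (-γ)` give a bound for each `N`, and `N` tends to infinity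
  · have hbound : ∀ N : ℕ, 0 < N → decompositionNorm p s μ (E.indicator fun _ => (1 : 𝕜)) ≤
        ENNReal.ofReal (K * (a * (1 - γ) / (a ^ (1 - γ) - (a / (N + 1 : ℕ)) ^ (1 - γ)))) := by
      intro N hN
      obtain ⟨hS0, g, hg1, hg2, hg3⟩ := hdec N _ rfl
      set S := ∑ i : Fin (N + 1), (a * ((i : ℕ) + 1) / (N + 1 : ℕ)) ^ (-γ) with hS
      have hn : (0 : ℝ) < (N + 1 : ℕ) := by positivity
      have hRiem := rpow_sub_rpow_le_sum ha hA (by linarith) N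
      rw [sub_sub_cancel, ← hS, div_le_iff₀ hA] at hRiem
      have hpos : 0 < a ^ (1 - γ) - (a / (N + 1 : ℕ)) ^ (1 - γ) := by
        refine sub_pos.2 (Real.rpow_lt_rpow (by positivity) (div_lt_self ha ?_) hA)
        exact_mod_cast Nat.lt_add_of_pos_left hN
      refine (decompositionNorm_le hg1 hg2).trans ((Finset.sum_le_sum fun k _ => hg3 k).trans ?_)
      rw [Finset.sum_const, Finset.card_univ, Fintype.card_fin, nsmul_eq_mul,
        ← ENNReal.ofReal_natCast, ← ENNReal.ofReal_mul hn.le]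
      refine ENNReal.ofReal_le_ofReal ?_
      rw [mul_div_assoc', mul_div_assoc', div_le_div_iff₀ hS0 hpos]
      calc (N + 1 : ℕ) * K * (a ^ (1 - γ) - (a / (N + 1 : ℕ)) ^ (1 - γ))
          ≤ (N + 1 : ℕ) * K * (a / (N + 1 : ℕ) * S * (1 - γ)) := by gcongr
        _ = _ := by field_simp
    have hlim : Tendsto (fun N : ℕ => ENNReal.ofReal
        (K * (a * (1 - γ) / (a ^ (1 - γ) - (a / (N + 1 : ℕ)) ^ (1 - γ))))) atTop
        (𝓝 (ENNReal.ofReal (K * (1 - γ) * a ^ γ))) := by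
      have h1 : Tendsto (fun N : ℕ => a / ((N + 1 : ℕ) : ℝ)) atTop (𝓝 0) :=
        (tendsto_const_div_atTop_nhds_zero_nat a).comp (tendsto_add_atTop_nat 1)
      have h2 : Tendsto (fun N : ℕ => (a / ((N + 1 : ℕ) : ℝ)) ^ (1 - γ)) atTop (𝓝 0) := by
        have := h1.rpow_const (p := 1 - γ) (Or.inr hA.le)
        rwa [Real.zero_rpow hA.ne'] at this
      have h3 : Tendsto (fun N : ℕ => K * (a * (1 - γ) /
          (a ^ (1 - γ) - (a / ((N + 1 : ℕ) : ℝ)) ^ (1 - γ)))) atTop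
          (𝓝 (K * (a * (1 - γ) / (a ^ (1 - γ) - 0)))) :=
        (tendsto_const_nhds.div (tendsto_const_nhds.sub h2)
          (by rw [sub_zero]; positivity)).const_mul K
      refine ENNReal.tendsto_ofReal ?_
      convert h3 using 2
      rw [sub_zero, Real.rpow_sub ha, Real.rpow_one]
      field_simp
    exact ge_of_tendsto hlim ((eventually_gt_atTop 0).mono hbound)
  · obtain ⟨-, g, hg1, hg2, -⟩ := hdec 0 _ rfl
    exact ⟨g, hg1, hg2⟩

lemma one_le_rearrangement_indicator {μ : Measure R} {E : Set R} {a : ℝ}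
    (hE : μ E = ENNReal.ofReal a) {t : ℝ} (ht : 0 ≤ t) (hta : t < a) :
    1 ≤ rearrangement μ (E.indicator fun _ => (1 : 𝕜)) t := by
  refine le_of_forall_lt fun y hy => lt_rearrangement_iff.2 ?_
  rw [distribution]
  refine lt_of_lt_of_le ((ENNReal.ofReal_lt_ofReal_iff (ht.trans_lt hta)).2 hta) ?_
  rw [← hE]
  refine measure_mono fun x hx => ?_
  show y < ‖E.indicator (fun _ => (1 : 𝕜)) x‖ₑ
  rwa [indicator_of_mem hx, enorm_one]

/-- On sets with equal partitions, the inequality for the decomposition norm is an equality for the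
indicator function, whose norm is finite and positive. -/
lemma lorentzNorm_indicator {p s : ℝ≥0∞} (hp : 1 < p) (hps : p < s) {μ : Measure R} [SFinite μ]
    {E : Set R} {a : ℝ} (ha : 0 < a) (hE : HasEqualPartitions μ E a) :
    MemLorentz p s μ (E.indicator fun _ => (1 : 𝕜)) ∧
    lorentzNorm p s μ (E.indicator fun _ => (1 : 𝕜)) ≠ 0 ∧
    lorentzNorm p s μ (E.indicator fun _ => (1 : 𝕜)) =
      sharpConstant p s * decompositionNorm p s μ (E.indicator fun _ => (1 : 𝕜)) := by
  have hp' : p ≠ ∞ := hps.ne_top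
  have h1 := one_lt_toReal hp hp'
  suffices H : (∃ g : Fin 1 → R → 𝕜, (∀ k, MemLorentz p s μ (g k)) ∧
      (E.indicator fun _ => (1 : 𝕜)) =ᵐ[μ] fun x => ∑ k, g k x) ∧
      lorentzNorm p s μ (E.indicator fun _ => (1 : 𝕜)) ≠ 0 ∧
      sharpConstant p s * decompositionNorm p s μ (E.indicator fun _ => (1 : 𝕜)) ≤
        lorentzNorm p s μ (E.indicator fun _ => (1 : 𝕜)) by
    obtain ⟨⟨g, hg, hEg⟩, h0, hle⟩ := H
    have htri := triangleInequality_sharpConstant (𝕜 := 𝕜) (μ := μ) hp hps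
    have hmem : MemLorentz p s μ (E.indicator fun _ => (1 : 𝕜)) := by
      refine ⟨aestronglyMeasurable_const.indicator hE.1, ?_⟩
      rw [lorentzNorm_congr_ae hEg]
      exact (htri 1 g hg).trans_lt (ENNReal.mul_lt_top (sharpConstant_ne_top hp hps).lt_top
        (ENNReal.sum_lt_top.2 fun k _ => (hg k).2))
    exact ⟨hmem, h0, le_antisymm
      (htri.decompositionInequality (sharpConstant_ne_top hp hps) _ hmem) hle⟩
  rcases eq_or_ne s ∞ with rfl | hs
  · set γ := 1 / p.toReal with hγ
    have hγ0 : 0 ≤ γ := by positivity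
    have hγ1 : γ < 1 := by rw [hγ, div_lt_one (by linarith)]; exact h1
    obtain ⟨hle, hg⟩ := decompositionNorm_indicator_le (𝕜 := 𝕜) (p := p) (s := ∞) ha hγ0 hγ1
      zero_le_one hE (fun g S hS hgS => by
        rw [lorentzNorm, if_pos rfl]
        refine iSup₂_le fun t ht => ?_
        refine (mul_le_mul_right (hgS t ht) _).trans ?_
        by_cases hta : t < a
        · rw [indicator_of_mem (mem_Iio.2 hta), ← hγ, ENNReal.ofReal_rpow_of_pos ht,
            ← ENNReal.ofReal_mul (by positivity), ← mul_div_assoc, ← Real.rpow_add ht]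
          simp
        · rw [indicator_of_notMem (by simpa using hta), mul_zero]
          exact zero_le)
    -- the supremum over `t < a` of `t ^ γ`
    have hlow : ENNReal.ofReal (a ^ γ) ≤ lorentzNorm p ∞ μ (E.indicator fun _ => (1 : 𝕜)) := by
      have hlim : Tendsto (fun t : ℝ => ENNReal.ofReal (t ^ γ)) (𝓝[<] a)
          (𝓝 (ENNReal.ofReal (a ^ γ))) :=
        ENNReal.tendsto_ofReal (((Real.continuousAt_rpow_const a γ (Or.inl ha.ne')).tendsto).mono_left
          nhdsWithin_le_nhds)
      refine le_of_tendsto hlim ?_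
      filter_upwards [self_mem_nhdsWithin, mem_nhdsWithin_of_mem_nhds (lt_mem_nhds ha)]
        with t hta ht
      rw [lorentzNorm, if_pos rfl]
      refine le_trans ?_ (le_iSup₂ (f := fun (t : ℝ) (_ : 0 < t) => ENNReal.ofReal t ^ (1 / p.toReal)
        * rearrangement μ (E.indicator fun _ => (1 : 𝕜)) t) t ht)
      rw [← hγ, ENNReal.ofReal_rpow_of_pos ht]
      exact le_mul_of_one_le_right zero_le (one_le_rearrangement_indicator hE.2.1 ht.le hta)
    have hpos : 0 < ENNReal.ofReal (a ^ γ) := ENNReal.ofReal_pos.2 (by positivity)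
    refine ⟨hg, (hpos.trans_le hlow).ne', le_trans ?_ hlow⟩
    have hγ2 : 0 < 1 - γ := by linarith
    rw [sharpConstant_top hp hp', ← hγ]
    refine (mul_le_mul_right hle _).trans ?_
    rw [← ENNReal.ofReal_mul (by positivity)]
    refine ENNReal.ofReal_le_ofReal (le_of_eq ?_)
    field_simp
  · have h2 := one_lt_toReal (hp.trans hps) hs
    have h3 : p.toReal < s.toReal := (ENNReal.toReal_lt_toReal hp' hs).2 hps
    set S := s.toReal with hS
    set B := S / p.toReal with hB
    set A := (S - B) / (S - 1) with hA
    have hS0 : 0 < S := by linarith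
    have hS1 : 0 < S - 1 := by linarith
    have hB0 : 0 < B := by positivity
    have hBS : B < S := div_lt_self hS0 h1
    have hB1 : 1 < B := (one_lt_div (by linarith)).2 h3
    have hA0 : 0 < A := div_pos (by linarith) hS1
    have hA1 : A ≤ 1 := (div_le_one hS1).2 (by linarith)
    have hAB : A * (S - 1) + B = S := by rw [hA, div_mul_cancel₀ _ hS1.ne']; ring
    obtain ⟨hle, hg⟩ := decompositionNorm_indicator_le (𝕜 := 𝕜) (p := p) (s := s) (γ := 1 - A)
      (K := (a ^ A / A) ^ (1 / S)) ha (by linarith) (by linarith) (by positivity) hE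
      (fun g T hT hgT => by
        rw [lorentzNorm_of_ne_top hS0 hs, ← hS, ← hB]
        have : ∫⁻ t in Ioi 0, rearrangement μ g t ^ S * ENNReal.ofReal (t ^ (B - 1)) ≤
            ENNReal.ofReal (a ^ A / A / T ^ S) := by
          calc ∫⁻ t in Ioi 0, rearrangement μ g t ^ S * ENNReal.ofReal (t ^ (B - 1))
              ≤ ∫⁻ t in Ioi 0, (Ioc 0 a).indicator (fun t =>
                  ENNReal.ofReal (t ^ (A - 1)) * ENNReal.ofReal (1 / T ^ S)) t := by
                refine setLIntegral_mono' measurableSet_Ioi fun t ht => ?_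
                have ht : 0 < t := ht
                have h4 := hgT t ht
                by_cases hta : t < a
                · rw [indicator_of_mem (mem_Iio.2 hta)] at h4
                  rw [indicator_of_mem (show t ∈ Ioc 0 a from ⟨ht, hta.le⟩)]
                  calc rearrangement μ g t ^ S * ENNReal.ofReal (t ^ (B - 1))
                      ≤ ENNReal.ofReal (t ^ (-(1 - A)) / T) ^ S *
                          ENNReal.ofReal (t ^ (B - 1)) := by gcongr
                    _ = _ := by
                      rw [ENNReal.ofReal_rpow_of_pos (by positivity),
                        ← ENNReal.ofReal_mul (by positivity), ← ENNReal.ofReal_mul (by positivity),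
                        Real.div_rpow (by positivity) hT.le, ← Real.rpow_mul ht.le,
                        div_mul_eq_mul_div, ← Real.rpow_add ht, mul_one_div]
                      congr 3
                      linear_combination hAB
                · rw [indicator_of_notMem (by simpa using hta), nonpos_iff_eq_zero] at h4
                  rw [h4, ENNReal.zero_rpow_of_pos hS0, zero_mul]
                  exact zero_le
            _ ≤ ∫⁻ t in Ioc 0 a, ENNReal.ofReal (t ^ (A - 1)) * ENNReal.ofReal (1 / T ^ S) := by
                rw [← lintegral_indicator measurableSet_Ioc]
                exact setLIntegral_le_lintegral _ _
            _ = _ := by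
                rw [lintegral_mul_const _ (by fun_prop), lintegral_rpow_Ioc (by linarith) le_rfl
                  ha.le, sub_add_cancel, Real.zero_rpow hA0.ne', sub_zero,
                  ← ENNReal.ofReal_mul (by positivity), mul_one_div]
        refine (ENNReal.rpow_le_rpow this (by positivity)).trans (le_of_eq ?_)
        rw [ENNReal.ofReal_rpow_of_pos (by positivity), Real.div_rpow (by positivity)
          (by positivity), ← Real.rpow_mul hT.le, mul_one_div_cancel hS0.ne', Real.rpow_one])
    have hlow : ENNReal.ofReal ((a ^ B / B) ^ (1 / S)) ≤
        lorentzNorm p s μ (E.indicator fun _ => (1 : 𝕜)) := by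
      rw [lorentzNorm_of_ne_top hS0 hs, ← hS, ← hB, ← ENNReal.ofReal_rpow_of_pos (by positivity)]
      refine ENNReal.rpow_le_rpow ?_ (by positivity)
      have h4 := lintegral_rpow_Ioc (r := B - 1) (by linarith) le_rfl ha.le
      rw [sub_add_cancel, Real.zero_rpow hB0.ne', sub_zero] at h4
      rw [← h4, ← restrict_Ioo_eq_restrict_Ioc]
      refine (setLIntegral_mono' measurableSet_Ioo fun t ht => ?_).trans
        (lintegral_mono_set Ioo_subset_Ioi_self)
      exact le_mul_of_one_le_left zero_le (ENNReal.one_le_rpow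
        (one_le_rearrangement_indicator hE.2.1 ht.1.le ht.2) hS0)
    have hpos : 0 < ENNReal.ofReal ((a ^ B / B) ^ (1 / S)) :=
      ENNReal.ofReal_pos.2 (by positivity)
    refine ⟨hg, (hpos.trans_le hlow).ne', le_trans ?_ hlow⟩
    rw [sharpConstant_of_ne_top hp hps hs hB hA]
    refine (mul_le_mul_right hle _).trans ?_
    rw [← hS, ← ENNReal.ofReal_mul (by positivity), sub_sub_cancel]
    refine ENNReal.ofReal_le_ofReal (le_of_eq ?_)
    have e1 : A⁻¹ ^ ((S - 1) / S) * A⁻¹ ^ (1 / S) = A⁻¹ := by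
      rw [← Real.rpow_add (by positivity), ← add_div, sub_add_cancel, div_self hS0.ne',
        Real.rpow_one]
    have e2 : (a ^ A) ^ (1 / S) * a ^ (1 - A) = (a ^ B) ^ (1 / S) := by
      rw [← Real.rpow_mul ha.le, ← Real.rpow_mul ha.le, ← Real.rpow_add ha]
      congr 1
      field_simp
      linear_combination -hAB
    rw [div_eq_mul_inv (a ^ A), div_eq_mul_inv (a ^ B), Real.mul_rpow (by positivity) (by positivity),
      Real.mul_rpow (by positivity) (by positivity), ← e2]
    calc B⁻¹ ^ (1 / S) * A⁻¹ ^ ((S - 1) / S) * ((a ^ A) ^ (1 / S) * A⁻¹ ^ (1 / S) * A * a ^ (1 - A))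
        = (A⁻¹ ^ ((S - 1) / S) * A⁻¹ ^ (1 / S)) * A *
            ((a ^ A) ^ (1 / S) * a ^ (1 - A) * B⁻¹ ^ (1 / S)) := by ring
      _ = _ := by rw [e1, inv_mul_cancel₀ hA0.ne', one_mul]

/-! ### Sets of prescribed measure in nonatomic measure spaces -/

lemma IsNonatomic.exists_subset_le_div_two_pow {μ : Measure R} (hμ : IsNonatomic μ) {A : Set R}
    (hA : MeasurableSet A) (hA0 : 0 < μ A) (hAtop : μ A ≠ ∞) (n : ℕ) :
    ∃ B ⊆ A, MeasurableSet B ∧ 0 < μ B ∧ μ B ≤ μ A / 2 ^ n := by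
  induction n with
  | zero => exact ⟨A, subset_rfl, hA, hA0, by simp⟩
  | succ n ih =>
    obtain ⟨B, hBA, hB, hB0, hBn⟩ := ih
    have hBtop : μ B ≠ ∞ := measure_ne_top_of_subset hBA hAtop
    obtain ⟨C, hCB, hC, hC0, hCB'⟩ := hμ B hB hB0
    have hadd : μ C + μ (B \ C) = μ B := by
      rw [← measure_union disjoint_sdiff_right (hB.diff hC), union_sdiff_cancel hCB]
    have hdiff : 0 < μ (B \ C) := by
      rw [measure_sdiff hCB hC.nullMeasurableSet hCB'.ne_top]
      exact tsub_pos_of_lt hCB'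
    have hhalf : μ B / 2 ≤ μ A / 2 ^ (n + 1) := by
      rw [pow_succ, ENNReal.div_eq_inv_mul, ENNReal.div_eq_inv_mul,
        ENNReal.mul_inv (Or.inr (by simp)) (Or.inr (by simp)), mul_comm _ (2⁻¹ : ℝ≥0∞), mul_assoc]
      gcongr
      rwa [ENNReal.div_eq_inv_mul] at hBn
    rcases le_total (μ C) (μ B / 2) with h | h
    · exact ⟨C, hCB.trans hBA, hC, hC0, h.trans hhalf⟩
    · refine ⟨B \ C, sdiff_subset.trans hBA, hB.diff hC, hdiff, le_trans ?_ hhalf⟩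
      rw [← ENNReal.add_halves (μ B)] at hadd
      have hne : μ B / 2 ≠ ∞ := (ENNReal.div_lt_top hBtop (by simp)).ne
      exact (ENNReal.add_le_add_iff_left hne).1
        (((add_le_add h le_rfl).trans hadd.le))

lemma IsNonatomic.exists_small_subset {μ : Measure R} (hμ : IsNonatomic μ) {A : Set R}
    (hA : MeasurableSet A) (hA0 : 0 < μ A) (hAtop : μ A ≠ ∞) {ε : ℝ≥0∞} (hε : 0 < ε) :
    ∃ B ⊆ A, MeasurableSet B ∧ 0 < μ B ∧ μ B ≤ ε := by
  obtain ⟨n, hn⟩ := ENNReal.exists_inv_two_pow_lt (ENNReal.div_pos hε.ne' hAtop).ne'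
  obtain ⟨B, hBA, hB, hB0, hBn⟩ := hμ.exists_subset_le_div_two_pow hA hA0 hAtop n
  refine ⟨B, hBA, hB, hB0, hBn.trans ?_⟩
  calc μ A / 2 ^ n = μ A * 2⁻¹ ^ n := by rw [div_eq_mul_inv, ENNReal.inv_pow]
    _ ≤ μ A * (ε / μ A) := by gcongr
    _ ≤ ε := ENNReal.mul_div_le

/-- Sierpiński's theorem: a nonatomic measure takes all values between `0` and the measure of a
given set. The subset of measure `b` is exhausted greedily. -/
lemma IsNonatomic.exists_subset_measure_eq {μ : Measure R} (hμ : IsNonatomic μ) {A : Set R}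
    (hA : MeasurableSet A) (hAtop : μ A ≠ ∞) {b : ℝ≥0∞} (hb : b ≤ μ A) :
    ∃ B ⊆ A, MeasurableSet B ∧ μ B = b := by
  have hbtop : b ≠ ∞ := ne_top_of_le_ne_top hAtop hb
  let T := {B : Set R // B ⊆ A ∧ MeasurableSet B ∧ μ B ≤ b}
  -- one greedy step gains at least half of the largest possible amount
  have hnext : ∀ B : T, ∃ B' : T, B.1 ⊆ B'.1 ∧ ∀ D, D ⊆ A \ B.1 → MeasurableSet D →
      μ B.1 + μ D ≤ b → μ B.1 + μ D / 2 ≤ μ B'.1 := by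
    rintro ⟨B, hBA, hB, hBb⟩
    set δ := ⨆ D : {D : Set R // D ⊆ A \ B ∧ MeasurableSet D ∧ μ B + μ D ≤ b}, μ D.1 with hδ
    have hδb : δ ≤ b := iSup_le fun D => le_add_self.trans D.2.2.2
    have hex : ∃ D : {D : Set R // D ⊆ A \ B ∧ MeasurableSet D ∧ μ B + μ D ≤ b},
        δ / 2 ≤ μ D.1 := by
      rcases eq_or_ne δ 0 with h0 | h0
      · exact ⟨⟨∅, empty_subset _, MeasurableSet.empty, by simpa using hBb⟩, by simp [h0]⟩
      · obtain ⟨D, hD⟩ := lt_iSup_iff.1 (ENNReal.half_lt_self h0 (ne_top_of_le_ne_top hbtop hδb))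
        exact ⟨D, hD.le⟩
    obtain ⟨⟨D, hD, hDm, hDb⟩, hDδ⟩ := hex
    have hunion : μ (B ∪ D) = μ B + μ D :=
      measure_union (disjoint_sdiff_right.mono_right hD) hDm
    refine ⟨⟨B ∪ D, union_subset hBA (hD.trans sdiff_subset), hB.union hDm, hunion ▸ hDb⟩,
      subset_union_left, fun D' hD' hDm' hDb' => ?_⟩
    simp only at hD' hDb' ⊢
    rw [hunion]
    gcongr
    refine le_trans ?_ hDδ
    gcongr
    exact le_iSup (fun D : {D : Set R // D ⊆ A \ B ∧ MeasurableSet D ∧ μ B + μ D ≤ b} => μ D.1)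
      ⟨D', hD', hDm', hDb'⟩
  choose next hsub hgain using hnext
  let B : ℕ → T := fun n => Nat.rec ⟨∅, empty_subset _, MeasurableSet.empty, by simp⟩
    (fun _ => next) n
  have hmono : Monotone fun n => (B n).1 := monotone_nat_of_le_succ fun n => hsub (B n)
  have hmeas : μ (⋃ n, (B n).1) = ⨆ n, μ (B n).1 := hmono.measure_iUnion
  have hUA : (⋃ n, (B n).1) ⊆ A := iUnion_subset fun n => (B n).2.1
  have hUm : MeasurableSet (⋃ n, (B n).1) := MeasurableSet.iUnion fun n => (B n).2.2.1
  have hUb : μ (⋃ n, (B n).1) ≤ b := hmeas ▸ iSup_le fun n => (B n).2.2.2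
  refine ⟨_, hUA, hUm, le_antisymm hUb ?_⟩
  by_contra! hlt
  have hdiff : 0 < μ (A \ ⋃ n, (B n).1) := by
    rw [measure_sdiff hUA hUm.nullMeasurableSet hlt.ne_top]
    exact tsub_pos_of_lt (hlt.trans_le hb)
  obtain ⟨D, hDA, hDm, hD0, hDε⟩ := hμ.exists_small_subset (hA.diff hUm) hdiff
    (measure_ne_top_of_subset sdiff_subset hAtop) (tsub_pos_of_lt hlt)
  have hgrow : ∀ n : ℕ, n * (μ D / 2) ≤ μ (B n).1 := by
    intro n
    induction n with
    | zero => simp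
    | succ n ih =>
      have := hgain (B n) D (hDA.trans (sdiff_subset_sdiff_right (subset_iUnion (fun n => (B n).1) n))) hDm (by
        calc μ (B n).1 + μ D ≤ μ (⋃ n, (B n).1) + (b - μ (⋃ n, (B n).1)) :=
              add_le_add (measure_mono (subset_iUnion (fun n => (B n).1) n)) hDε
          _ = b := add_tsub_cancel_of_le hUb)
      refine le_trans ?_ this
      push_cast
      rw [add_mul, one_mul]
      gcongr
  obtain ⟨n, hn⟩ := ENNReal.exists_nat_mul_gt (ENNReal.half_pos hD0.ne').ne' hbtop
  exact (hn.trans_le (hgrow n)).not_ge (B n).2.2.2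

lemma IsNonatomic.exists_disjoint_subsets {μ : Measure R} (hμ : IsNonatomic μ) {c : ℝ≥0∞}
    (hc : c ≠ ∞) (n : ℕ) : ∀ A : Set R, MeasurableSet A → μ A = n * c →
      ∃ D : Fin n → Set R, (∀ j, MeasurableSet (D j)) ∧ Pairwise (Function.onFun Disjoint D) ∧
        (∀ j, D j ⊆ A) ∧ ∀ j, μ (D j) = c := by
  induction n with
  | zero => exact fun A _ _ => ⟨fun _ => ∅, fun j => j.elim0, fun j => j.elim0, fun j => j.elim0,
      fun j => j.elim0⟩
  | succ n ih =>
    intro A hA hAc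
    have hAtop : μ A ≠ ∞ := by rw [hAc]; finiteness
    have hsplit : μ A = c + n * c := by rw [hAc]; push_cast; ring
    obtain ⟨B, hBA, hB, hBc⟩ := hμ.exists_subset_measure_eq hA hAtop (b := c)
      (by rw [hsplit]; exact le_self_add)
    obtain ⟨D, hDm, hDd, hDA, hDc⟩ := ih (A \ B) (hA.diff hB) (by
      rw [measure_sdiff hBA hB.nullMeasurableSet (hBc ▸ hc), hBc, hsplit,
        ENNReal.add_sub_cancel_left hc])
    have hBD : ∀ j, Disjoint B (D j) := fun j => disjoint_sdiff_right.mono_right (hDA j)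
    refine ⟨Fin.cons B D, Fin.cases hB hDm, ?_,
      Fin.cases hBA fun j => (hDA j).trans sdiff_subset, Fin.cases hBc hDc⟩
    intro i
    refine Fin.cases ?_ (fun i => ?_) i
    · intro j
      refine Fin.cases (fun h => (h rfl).elim) (fun j _ => ?_) j
      exact hBD j
    · intro j
      refine Fin.cases (fun _ => ?_) (fun j h => ?_) j
      · exact (hBD i).symm
      · exact hDd fun hij => h (congrArg Fin.succ hij)

lemma IsNonatomic.hasEqualPartitions {μ : Measure R} (hμ : IsNonatomic μ) {E : Set R}
    (hE : MeasurableSet E) (hEtop : μ E ≠ ∞) : HasEqualPartitions μ E (μ E).toReal := by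
  refine ⟨hE, (ENNReal.ofReal_toReal hEtop).symm, fun n hn => ?_⟩
  refine hμ.exists_disjoint_subsets ENNReal.ofReal_ne_top n E hE ?_
  have hn' : (n : ℝ) ≠ 0 := by positivity
  rw [← ENNReal.ofReal_natCast, ← ENNReal.ofReal_mul (by positivity), mul_div_cancel₀ _ hn',
    ENNReal.ofReal_toReal hEtop]

lemma hasEqualPartitions_Icc :
    HasEqualPartitions (volume.restrict (Ioi (0 : ℝ))) (Icc (0 : ℝ) 1) 1 := by
  have hvol : ∀ x y : ℝ, 0 ≤ x →
      volume.restrict (Ioi (0 : ℝ)) (Ioc x y) = ENNReal.ofReal (y - x) := by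
    intro x y hx
    rw [Measure.restrict_apply measurableSet_Ioc, inter_eq_left.2, Real.volume_Ioc]
    exact fun t ht => mem_Ioi.2 (hx.trans_lt ht.1)
  refine ⟨measurableSet_Icc, ?_, fun n hn => ⟨fun j => Ioc ((j : ℕ) / n : ℝ) (((j : ℕ) + 1) / n),
    fun j => measurableSet_Ioc, ?_, fun j t ht => ?_, fun j => ?_⟩⟩
  · have h := hvol 0 1 le_rfl
    rw [sub_zero] at h
    rw [← h, Measure.restrict_apply measurableSet_Icc, Measure.restrict_apply measurableSet_Ioc]
    congr 1
    ext t
    simp only [mem_inter_iff, mem_Icc, mem_Ioi, mem_Ioc]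
    exact ⟨fun h => ⟨⟨h.2, h.1.2⟩, h.2⟩, fun h => ⟨⟨h.2.le, h.1.2⟩, h.2⟩⟩
  · have hlt : ∀ i j : Fin n, i < j → Disjoint (Ioc ((i : ℕ) / n : ℝ) (((i : ℕ) + 1) / n))
        (Ioc ((j : ℕ) / n : ℝ) (((j : ℕ) + 1) / n)) := by
      intro i j hij
      refine Set.Ioc_disjoint_Ioc_of_le ?_
      gcongr
      exact_mod_cast hij
    intro i j hij
    rcases lt_or_gt_of_ne hij with h | h
    · exact hlt i j h
    · exact (hlt j i h).symm
  · have hn' : (0 : ℝ) < n := by exact_mod_cast hn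
    have h1 : (0 : ℝ) ≤ (j : ℕ) / n := by positivity
    have h2 : (((j : ℕ) : ℝ) + 1) / n ≤ 1 := by
      rw [div_le_one hn']
      exact_mod_cast j.2
    exact ⟨h1.trans ht.1.le, ht.2.trans h2⟩
  · rw [hvol _ _ (by positivity), ← sub_div, add_sub_cancel_left]

end LorentzSpace

theorem mainTheorem2 {𝕜 : Type*} [RCLike 𝕜] {R : Type*} [MeasurableSpace R]
    (μ : MeasureTheory.Measure R) [MeasureTheory.SigmaFinite μ]
    (hμ : LorentzSpace.IsNonatomic μ) (p s : ℝ≥0∞) (hp : 1 < p) (hps : p < s) :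
    -- the triangle inequality with the constant `c_{p,s}`
    LorentzSpace.TriangleInequality 𝕜 p s μ (LorentzSpace.sharpConstant p s) ∧
    -- optimality of the constant, on every nontrivial measure space
    (μ ≠ 0 → ∀ C : ℝ≥0∞, LorentzSpace.TriangleInequality 𝕜 p s μ C →
      LorentzSpace.sharpConstant p s ≤ C) ∧
    -- the equivalent inequality for the decomposition norm
    (∀ C : ℝ≥0∞, LorentzSpace.TriangleInequality 𝕜 p s μ C ↔
      LorentzSpace.DecompositionInequality 𝕜 p s μ C) ∧
    LorentzSpace.DecompositionInequality 𝕜 p s μ (LorentzSpace.sharpConstant p s) ∧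
    -- equality for the indicator of `[0,1]` on the half-line with Lebesgue measure
    (LorentzSpace.MemLorentz p s (MeasureTheory.volume.restrict (Set.Ioi (0 : ℝ)))
        ((Set.Icc (0 : ℝ) 1).indicator fun _ => (1 : 𝕜)) ∧
      LorentzSpace.lorentzNorm p s (MeasureTheory.volume.restrict (Set.Ioi (0 : ℝ)))
          ((Set.Icc (0 : ℝ) 1).indicator fun _ => (1 : 𝕜)) =
        LorentzSpace.sharpConstant p s *
          LorentzSpace.decompositionNorm p s (MeasureTheory.volume.restrict (Set.Ioi (0 : ℝ)))
            ((Set.Icc (0 : ℝ) 1).indicator fun _ => (1 : 𝕜))) := by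
  have htri := LorentzSpace.triangleInequality_sharpConstant (𝕜 := 𝕜) (μ := μ) hp hps
  have hiff := LorentzSpace.triangleInequality_iff_decompositionInequality (𝕜 := 𝕜) (μ := μ) hp hps
  have hind := LorentzSpace.lorentzNorm_indicator (𝕜 := 𝕜) hp hps one_pos
    LorentzSpace.hasEqualPartitions_Icc
  refine ⟨htri, fun hμ0 C hC => ?_, hiff, (hiff _).1 htri, hind.1, hind.2.2⟩
  -- the equality for the indicator of a set of finite positive measure forces `c_{p,s} ≤ C`
  obtain ⟨E, hE, -, hE0, hEtop⟩ := Measure.exists_subset_measure_lt_top (μ := μ) (r := 0)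
    MeasurableSet.univ (by simpa [pos_iff_ne_zero] using hμ0)
  obtain ⟨hmem, h0, heq⟩ := LorentzSpace.lorentzNorm_indicator (𝕜 := 𝕜) hp hps
    (ENNReal.toReal_pos hE0.ne' hEtop.ne) (hμ.hasEqualPartitions hE hEtop.ne)
  have hle := (hiff C).1 hC _ hmem
  rw [heq] at hle h0
  have hd : LorentzSpace.decompositionNorm p s μ (E.indicator fun _ => (1 : 𝕜)) ≠ ∞ := by
    intro htop
    have h1 := hmem.2
    rw [heq, htop, ENNReal.mul_top (left_ne_zero_of_mul h0)] at h1
    exact h1.ne rfl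
  exact (ENNReal.mul_le_mul_iff_left (right_ne_zero_of_mul h0) hd).1 hle
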